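/- Let $K$ be a field. Quivers $Q$ are finite, with vertex set $Q_0$ and arrow set $Q_1$; $KQ$ is the path algebra, and $ab$ denotes the path $a$ followed by $b$. A $K$-algebra $A$ is *almost gentle* if it is Morita equivalent (over $K$) to an algebra $KQ/I$, with $I$ an admissible ideal, such that (S0) $I$ is generated by paths of length $2$ and (S1) for every arrow $a$ there is at most one arrow $b$ with $ab\notin I$ and at most one arrow $c$ with $ca\notin I$. The *trivial extension* of $A$ is $T(A)=A\oplus D(A)$, $D(A)=\operatorname{Hom}_K(A,K)$, with $(a,f)(b,g)=(ab,ag+fb)$, where $(afb)(x)=f(bxa)$. A *simple cycle* in $Q$ is a closed path of positive length without repeated arrows. A *defining pair* in $Q$ is a set $\mathcal S$ of simple cycles with a function $\mu\colon\mathcal S\to\mathbb Z_{>0}$ such that: (D0) $\mu(C)>1$ if $C\in\mathcal S$ is a loop; (D1) $\mathcal S$ is closed under cyclic permutation; (D2) $\mu$ is invariant under cyclic permutation; (D3) every arrow occurs in some $C\in\mathcal S$; (D4) two cycles in $\mathcal S$ with a common arrow are cyclic permutations of each other. The *symmetric special multiserial algebra defined by* $(\mathcal S,\mu)$ is $KQ/I$,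 where $I$ is generated by: $C^{\mu(C)}-C'^{\mu(C')}$ for $C,C'\in\mathcal S$ starting at the same vertex; $C^{\mu(C)}a$ for $C\in\mathcal S$ with first arrow $a$; and the paths $ab$ of length $2$ that are not subpaths of $C^{\mu(C)}$ for any $C\in\mathcal S$. A *Brauer configuration* $\Gamma=(\Gamma_0,\Gamma_1,\mu,\mathfrak o)$ consists of a finite set $\Gamma_0$ of vertices, a finite collection $\Gamma_1$ of labelled polygons, each a multiset of at least two vertices, a function $\mu\colon\Gamma_0\to\mathbb Z_{>0}$, and for each vertex $\alpha$ a cyclic ordering $\mathfrak o_\alpha$ of the polygons containing $\alpha$, counted with multiplicity; every vertex lies in some polygon and, writing $\operatorname{val}(\alpha)$ for the total number of occurrences of $\alpha$ in polygons, every polygon has a vertex $\alpha$ with $\operatorname{val}(\alpha)\mu(\alpha)>1$. Its quiver has the polygons as vertices and, for each $\alpha$ with $\operatorname{val}(\alpha)\mu(\alpha)>1$, one arrow from each entry of $\mathfrak o_\alpha$ to its successor; going once around $\mathfrak o_\alpha$ from any entry gives a *special $\alpha$-cycle*. The *Brauer configuration algebra* of $\Gamma$ is the quotient of the path algebra of this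 quiver by the same three kinds of relations, with $C^{\mu(C)}$ replaced by $C^{\mu(\alpha)}$ for the special $\alpha$-cycles $C$. **Corollary 5.7.** (1) Let $(\mathcal S,\mu)$ be a defining pair with $\mu\equiv 1$ in a finite quiver $Q$ in which every vertex is the start or the end of some arrow. Then the symmetric special multiserial algebra defined by $(\mathcal S,\mu)$ is isomorphic, as a $K$-algebra, to the trivial extension $T(A)$ of an almost gentle algebra $A$. (2) The Brauer configuration algebra of every Brauer configuration with $\mu\equiv 1$ is isomorphic, as a $K$-algebra, to the trivial extension $T(A)$ of an almost gentle algebra $A$. In both cases, if the given algebra is indecomposable (nonzero, with no central idempotents except $0$ and $1$), then $A$ can be chosen indecomposable. -/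

import Mathlib

universe u v w

noncomputable section

open scoped Classical

/-! ### Finite quivers and their path algebras -/

/-- A finite quiver: finite sets of vertices and of arrows, and the start and the end
vertex of every arrow. -/
structure FinQuiver where
  V : Type v
  E : Type v
  [finV : Fintype V]
  [finE : Fintype E]
  s : E → V
  t : E → V

attribute [instance] FinQuiver.finV FinQuiver.finE

/-- `Q.IsWalk x l y`: the list of arrows `l = a₁ ⋯ aₙ` is a path from `x` to `y`
(`a₁` followed by `a₂`, and so on); the empty list is the trivial path at `x = y`. -/
def FinQuiver.IsWalk (Q : FinQuiver.{v}) : Q.V → List Q.E → Q.V → Prop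
  | x, [], y => x = y
  | x, a :: l, y => Q.s a = x ∧ Q.IsWalk (Q.t a) l y

theorem FinQuiver.IsWalk.append {Q : FinQuiver.{v}} {l l' : List Q.E} :
    ∀ {x y z : Q.V}, Q.IsWalk x l y → Q.IsWalk y l' z → Q.IsWalk x (l ++ l') z := by
  induction l with
  | nil => intro x y z h h'; cases h; exact h'
  | cons a l ih => intro x y z h h'; exact ⟨h.1, ih h.2 h'⟩

/-- A path in `Q`. For every vertex there is one trivial path. -/
@[ext] structure QPath (Q : FinQuiver.{v}) where
  source : Q.V
  arrows : List Q.E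
  target : Q.V
  isWalk : Q.IsWalk source arrows target

namespace QPath

variable {Q : FinQuiver.{v}}

/-- The length of a path. -/
def length (p : QPath Q) : ℕ := p.arrows.length

/-- The trivial path at a vertex. -/
def trivial (x : Q.V) : QPath Q := ⟨x, [], x, rfl⟩

/-- An arrow as a path of length one. -/
def ofArrow (a : Q.E) : QPath Q := ⟨Q.s a, [a], Q.t a, rfl, rfl⟩

/-- The path `p` followed by the path `q`. -/
def comp (p q : QPath Q) (h : p.target = q.source) : QPath Q :=
  ⟨p.source, p.arrows ++ q.arrows, q.target, p.isWalk.append (h ▸ q.isWalk)⟩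

end QPath

/-- The path algebra `KQ`: the vector space with basis the paths of `Q`. -/
def PathAlgebra (K : Type u) [Field K] (Q : FinQuiver.{v}) : Type (max u v) :=
  QPath Q →₀ K

namespace PathAlgebra

variable (K : Type u) [Field K] {Q : FinQuiver.{v}}

instance : AddCommGroup (PathAlgebra K Q) := inferInstanceAs (AddCommGroup (QPath Q →₀ K))
instance : Module K (PathAlgebra K Q) := inferInstanceAs (Module K (QPath Q →₀ K))

/-- The basis element of `KQ` given by a path. -/
def single (p : QPath Q) : PathAlgebra K Q := Finsupp.single p 1

/-- The product of two paths: their concatenation if the second starts where the first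
ends, and zero otherwise. -/
def pathMul (p q : QPath Q) : PathAlgebra K Q :=
  if h : p.target = q.source then single K (p.comp q h) else 0

/-- The bilinear extension of the product of paths. -/
def mulLin : PathAlgebra K Q →ₗ[K] PathAlgebra K Q →ₗ[K] PathAlgebra K Q :=
  Finsupp.linearCombination K
    (fun p : QPath Q => Finsupp.linearCombination K (fun q : QPath Q => pathMul K p q))

instance : Mul (PathAlgebra K Q) := ⟨fun x y => mulLin K x y⟩

instance : One (PathAlgebra K Q) := ⟨∑ x : Q.V, single K (QPath.trivial x)⟩

theorem mul_def (x y : PathAlgebra K Q) : x * y = mulLin K x y := rfl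

theorem one_def : (1 : PathAlgebra K Q) = ∑ x : Q.V, single K (QPath.trivial x) := rfl

theorem single_mul_single (p q : QPath Q) : single K p * single K q = pathMul K p q := by
  rw [mul_def]
  unfold mulLin single
  erw [Finsupp.linearCombination_single, one_smul, Finsupp.linearCombination_single, one_smul]

theorem zero_mul' (y : PathAlgebra K Q) : 0 * y = 0 := by
  rw [mul_def, map_zero, LinearMap.zero_apply]

theorem mul_zero' (x : PathAlgebra K Q) : x * 0 = 0 := by
  rw [mul_def, map_zero]

theorem add_mul' (x y z : PathAlgebra K Q) : (x + y) * z = x * z + y * z := by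
  simp only [mul_def, map_add, LinearMap.add_apply]

theorem mul_add' (x y z : PathAlgebra K Q) : x * (y + z) = x * y + x * z := by
  simp only [mul_def, map_add]

theorem smul_mul' (c : K) (x y : PathAlgebra K Q) : c • x * y = c • (x * y) := by
  simp only [mul_def, map_smul, LinearMap.smul_apply]

theorem mul_smul' (c : K) (x y : PathAlgebra K Q) : x * c • y = c • (x * y) := by
  simp only [mul_def, map_smul]

/-- A property of elements of `KQ` holds if it holds for paths and is preserved by linear
combinations. -/
theorem induction {P : PathAlgebra K Q → Prop} (x : PathAlgebra K Q) (h0 : P 0)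
    (hs : ∀ p, P (single K p)) (ha : ∀ x y, P x → P y → P (x + y))
    (hm : ∀ (c : K) x, P x → P (c • x)) : P x := by
  refine Finsupp.induction_linear (motive := P) x h0 ha fun p c => ?_
  have h := hm c _ (hs p)
  unfold single at h
  erw [Finsupp.smul_single_one] at h
  exact h

theorem pathMul_assoc (p q r : QPath Q) :
    single K p * single K q * single K r = single K p * (single K q * single K r) := by
  rw [single_mul_single, single_mul_single]
  unfold pathMul
  by_cases h : p.target = q.source <;> by_cases h' : q.target = r.source
  · rw [dif_pos h, dif_pos h', single_mul_single, single_mul_single, pathMul, pathMul,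
      dif_pos (show (p.comp q h).target = r.source from h'),
      dif_pos (show p.target = (q.comp r h').source from h)]
    congr 1
    ext1
    · rfl
    · exact List.append_assoc _ _ _
    · rfl
  · rw [dif_pos h, dif_neg h', single_mul_single, pathMul,
      dif_neg (show ¬ (p.comp q h).target = r.source from h'), mul_def, map_zero]
  · rw [dif_neg h, dif_pos h', single_mul_single, pathMul,
      dif_neg (show ¬ p.target = (q.comp r h').source from h), mul_def, map_zero,
      LinearMap.zero_apply]
  · rw [dif_neg h, dif_neg h', mul_def, mul_def, map_zero, map_zero, LinearMap.zero_apply]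

theorem mul_assoc' (x y z : PathAlgebra K Q) : x * y * z = x * (y * z) := by
  induction x using induction with
  | h0 => simp only [zero_mul']
  | ha x x' h h' => simp only [add_mul', h, h']
  | hm c x h => simp only [smul_mul', h]
  | hs p =>
    induction y using induction with
    | h0 => simp only [zero_mul', mul_zero']
    | ha y y' h h' => simp only [add_mul', mul_add', h, h']
    | hm c y h => simp only [smul_mul', mul_smul', h]
    | hs q =>
      induction z using induction with
      | h0 => simp only [mul_zero']
      | ha z z' h h' => simp only [mul_add', h, h']
      | hm c z h => simp only [mul_smul', h]
      | hs r => exact pathMul_assoc K p q r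

theorem one_mul' (x : PathAlgebra K Q) : 1 * x = x := by
  induction x using induction with
  | h0 => exact mul_zero' K _
  | ha x x' h h' => rw [mul_add', h, h']
  | hm c x h => rw [mul_smul', h]
  | hs p =>
    rw [one_def, mul_def, map_sum, LinearMap.sum_apply, Finset.sum_eq_single p.source]
    · rw [← mul_def, single_mul_single, pathMul,
        dif_pos (show (QPath.trivial p.source).target = p.source from rfl)]
      rfl
    · intro x _ hx
      rw [← mul_def, single_mul_single, pathMul,
        dif_neg (show ¬ (QPath.trivial x).target = p.source from hx)]
    · intro h
      exact absurd (Finset.mem_univ _) h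

theorem mul_one' (x : PathAlgebra K Q) : x * 1 = x := by
  induction x using induction with
  | h0 => exact zero_mul' K _
  | ha x x' h h' => rw [add_mul', h, h']
  | hm c x h => rw [smul_mul', h]
  | hs p =>
    rw [one_def, mul_def, map_sum, Finset.sum_eq_single p.target]
    · rw [← mul_def, single_mul_single, pathMul,
        dif_pos (show p.target = (QPath.trivial p.target).source from rfl)]
      congr 1
      ext1
      · rfl
      · exact List.append_nil _
      · rfl
    · intro x _ hx
      rw [← mul_def, single_mul_single, pathMul,
        dif_neg (show ¬ p.target = (QPath.trivial x).source from Ne.symm hx)]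
    · intro h
      exact absurd (Finset.mem_univ _) h

instance : Ring (PathAlgebra K Q) :=
  { (inferInstance : AddCommGroup (PathAlgebra K Q)),
    (inferInstance : Mul (PathAlgebra K Q)), (inferInstance : One (PathAlgebra K Q)) with
    zero_mul := zero_mul' K
    mul_zero := mul_zero' K
    left_distrib := mul_add' K
    right_distrib := add_mul' K
    mul_assoc := mul_assoc' K
    one_mul := one_mul' K
    mul_one := mul_one' K }

instance : Algebra K (PathAlgebra K Q) := Algebra.ofModule (smul_mul' K) (mul_smul' K)

/-- The element of `KQ` given by an arrow. -/
def arrow (a : Q.E) : PathAlgebra K Q := single K (QPath.ofArrow a)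

/-- The element `a₁ ⋯ aₙ` of `KQ` given by a list of arrows `[a₁, …, aₙ]`. -/
def word (l : List Q.E) : PathAlgebra K Q := (l.map (arrow K)).prod

end PathAlgebra

/-- The algebra `KQ/I` of a two-sided ideal `I`. -/
abbrev QuiverQuotient (K : Type u) [Field K] (Q : FinQuiver.{v})
    (I : TwoSidedIdeal (PathAlgebra K Q)) : Type (max u v) :=
  I.ringCon.Quotient

/-! ### Almost gentle algebras -/

/-- An admissible ideal: every element of `I` is a combination of paths of length at least
two, and all sufficiently long paths belong to `I`. -/
def IsAdmissible {K : Type u} [Field K] {Q : FinQuiver.{v}}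
    (I : TwoSidedIdeal (PathAlgebra K Q)) : Prop :=
  (∀ x ∈ I, ∀ p ∈ Finsupp.support (M := K) x, 2 ≤ QPath.length p) ∧
    ∃ N : ℕ, ∀ p : QPath Q, N ≤ p.length → PathAlgebra.single K p ∈ I

/-- `I` is generated by paths of length two. -/
def IsGeneratedByLengthTwoPaths {K : Type u} [Field K] {Q : FinQuiver.{v}}
    (I : TwoSidedIdeal (PathAlgebra K Q)) : Prop :=
  ∃ R : Set (QPath Q), (∀ p ∈ R, p.length = 2) ∧
    I = TwoSidedIdeal.span (PathAlgebra.single K '' R)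

/-- The special multiserial condition: for every arrow `a` there are at most one arrow `b`
with `ab ∉ I` and at most one arrow `c` with `ca ∉ I`. (If two arrows cannot be composed,
their product is zero and lies in `I`.) -/
def IsSpecialMultiserialIdeal {K : Type u} [Field K] {Q : FinQuiver.{v}}
    (I : TwoSidedIdeal (PathAlgebra K Q)) : Prop :=
  ∀ a : Q.E,
    (∀ b b' : Q.E, PathAlgebra.arrow K a * PathAlgebra.arrow K b ∉ I →
      PathAlgebra.arrow K a * PathAlgebra.arrow K b' ∉ I → b = b') ∧
    (∀ c c' : Q.E, PathAlgebra.arrow K c * PathAlgebra.arrow K a ∉ I →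
      PathAlgebra.arrow K c' * PathAlgebra.arrow K a ∉ I → c = c')

/-- A `K`-algebra is almost gentle if it is Morita equivalent to an algebra `KQ/I`, with `Q` a
finite quiver and `I` an admissible ideal generated by paths of length two, which satisfies
the special multiserial condition. -/
def IsAlmostGentle (K : Type u) [Field K] (A : Type (max u v)) [Ring A] [Algebra K A] : Prop :=
  ∃ (Q : FinQuiver.{v}) (I : TwoSidedIdeal (PathAlgebra K Q)),
    IsAdmissible I ∧ IsGeneratedByLengthTwoPaths I ∧ IsSpecialMultiserialIdeal I ∧
      IsMoritaEquivalent K A (QuiverQuotient K Q I)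

/-- A ring is indecomposable if it is nonzero and its only central idempotents are `0`
and `1`, that is, if it is not a product of two nonzero rings. -/
def IsIndecomposableRing (A : Type w) [Ring A] : Prop :=
  Nontrivial A ∧ ∀ e : A, e * e = e → (∀ x, e * x = x * e) → e = 0 ∨ e = 1

/-! ### Trivial extensions -/

/-- The dual `D(A) = Hom_K(A, K)`, to be viewed as an `A`-`A`-bimodule by
`(a f b)(x) = f (b x a)`. -/
def DualBimodule (K : Type u) [Field K] (A : Type w) [Ring A] [Algebra K A] : Type (max u w) :=
  A →ₗ[K] K

namespace DualBimodule

variable (K : Type u) [Field K] (A : Type w) [Ring A] [Algebra K A]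

instance : AddCommGroup (DualBimodule K A) := inferInstanceAs (AddCommGroup (A →ₗ[K] K))
instance : Module K (DualBimodule K A) := inferInstanceAs (Module K (A →ₗ[K] K))
instance : FunLike (DualBimodule K A) A K := inferInstanceAs (FunLike (A →ₗ[K] K) A K)

variable {K A}

@[ext] theorem ext {f g : DualBimodule K A} (h : ∀ x, f x = g x) : f = g := LinearMap.ext h

/-- The left action `(a f)(x) = f (x a)`. -/
instance : Module A (DualBimodule K A) where
  smul a f := (show A →ₗ[K] K from f) ∘ₗ LinearMap.mulRight K a
  one_smul f := ext fun x => congrArg f (mul_one x)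
  mul_smul a b f := ext fun x => congrArg f (mul_assoc x a b).symm
  smul_zero _ := rfl
  smul_add _ _ _ := rfl
  add_smul a b f := ext fun x => (congrArg f (mul_add x a b)).trans (LinearMap.map_add f _ _)
  zero_smul f := ext fun x => (congrArg f (mul_zero x)).trans (LinearMap.map_zero f)

/-- The right action `(f b)(x) = f (b x)`. -/
instance : Module Aᵐᵒᵖ (DualBimodule K A) where
  smul b f := (show A →ₗ[K] K from f) ∘ₗ LinearMap.mulLeft K b.unop
  one_smul f := ext fun x => congrArg f (one_mul x)
  mul_smul a b f := ext fun x => congrArg f (mul_assoc b.unop a.unop x)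
  smul_zero _ := rfl
  smul_add _ _ _ := rfl
  add_smul a b f := ext fun x =>
    (congrArg f (add_mul a.unop b.unop x)).trans (LinearMap.map_add f _ _)
  zero_smul f := ext fun x => (congrArg f (zero_mul x)).trans (LinearMap.map_zero f)

theorem smul_apply (a : A) (f : DualBimodule K A) (x : A) : (a • f) x = f (x * a) := rfl

theorem op_smul_apply (b : A) (f : DualBimodule K A) (x : A) :
    (MulOpposite.op b • f) x = f (b * x) := rfl

instance : SMulCommClass A Aᵐᵒᵖ (DualBimodule K A) where
  smul_comm a b f := ext fun x => congrArg f (mul_assoc b.unop x a).symm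

instance : IsScalarTower K A (DualBimodule K A) where
  smul_assoc c a f := ext fun x =>
    (congrArg f (mul_smul_comm c x a)).trans (LinearMap.map_smul f c (x * a))

instance : IsScalarTower K Aᵐᵒᵖ (DualBimodule K A) where
  smul_assoc c b f := ext fun x =>
    (congrArg f (smul_mul_assoc c b.unop x)).trans (LinearMap.map_smul f c (b.unop * x))

end DualBimodule

/-- The trivial extension `T(A) = A ⋉ D(A)`, with multiplication
`(a, f) (b, g) = (a b, a g + f b)`. -/
abbrev TrivialExtension (K : Type u) [Field K] (A : Type w) [Ring A] [Algebra K A] :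
    Type (max u w) :=
  TrivSqZeroExt A (DualBimodule K A)

/-! ### Algebras defined by cycles -/

/-- The ideal of `KQ` determined by a set `W` of powers `C^n` of cycles, `n ≥ 1`. It is
generated by the differences `w - w'` of elements of `W` which start and end at the same
vertex, by the paths `w a` with `w` in `W` and `a` the first arrow of `w`, and by the paths
`a b` of length two which are not subpaths of any `w` in `W`. -/
def cycleIdeal (K : Type u) [Field K] {Q : FinQuiver.{v}} (W : Set (List Q.E)) :
    TwoSidedIdeal (PathAlgebra K Q) :=
  TwoSidedIdeal.span
    ({r | ∃ w ∈ W, ∃ w' ∈ W, ∃ x : Q.V, Q.IsWalk x w x ∧ Q.IsWalk x w' x ∧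
        r = PathAlgebra.word K w - PathAlgebra.word K w'} ∪
     {r | ∃ w ∈ W, ∃ a : Q.E, w.head? = some a ∧ r = PathAlgebra.word K (w ++ [a])} ∪
     {r | ∃ a b : Q.E, Q.t a = Q.s b ∧ (∀ w ∈ W, ¬ [a, b] <:+: w) ∧
        r = PathAlgebra.word K [a, b]})

/-- The `n`-th power of a cycle. -/
def cyclePow {E : Type v} (C : List E) (n : ℕ) : List E := (List.replicate n C).flatten

/-- A simple cycle: a closed path of positive length without repeated arrows. -/
def FinQuiver.IsSimpleCycle (Q : FinQuiver.{v}) (C : List Q.E) : Prop :=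
  C ≠ [] ∧ (∃ x, Q.IsWalk x C x) ∧ C.Nodup

/-- A defining pair `(S, ν)` in `Q`: a set `S` of simple cycles with positive
multiplicities `ν` (only the values of `ν` on `S` matter). -/
structure IsDefiningPair (Q : FinQuiver.{v}) (S : Set (List Q.E)) (ν : List Q.E → ℕ) :
    Prop where
  simple : ∀ C ∈ S, Q.IsSimpleCycle C
  pos : ∀ C ∈ S, 0 < ν C
  /-- loops in `S` have multiplicity greater than one -/
  loop : ∀ a : Q.E, [a] ∈ S → 1 < ν [a]
  rotate_mem : ∀ C ∈ S, ∀ C', C ~r C' → C' ∈ S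
  rotate_mult : ∀ C ∈ S, ∀ C' ∈ S, C ~r C' → ν C = ν C'
  cover : ∀ a : Q.E, ∃ C ∈ S, a ∈ C
  unique : ∀ a : Q.E, ∀ C ∈ S, ∀ C' ∈ S, a ∈ C → a ∈ C' → C ~r C'

/-- The algebra defined by the cycles `(S, ν)`. -/
abbrev AlgebraDefinedByCycles (K : Type u) [Field K] (Q : FinQuiver.{v})
    (S : Set (List Q.E)) (ν : List Q.E → ℕ) : Type (max u v) :=
  QuiverQuotient K Q (cycleIdeal K {w | ∃ C ∈ S, w = cyclePow C (ν C)})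

/-! ### Brauer configuration algebras -/

/-- A Brauer configuration `(Γ₀, Γ₁, μ, 𝔬)`. -/
structure BrauerConfiguration where
  /-- the vertices -/
  Γ₀ : Type v
  /-- the (labels of the) polygons -/
  Γ₁ : Type v
  [fin₀ : Fintype Γ₀]
  [fin₁ : Fintype Γ₁]
  /-- the multiset of vertices of a polygon -/
  poly : Γ₁ → Multiset Γ₀
  /-- the multiplicity function -/
  μ : Γ₀ → ℕ
  /-- the orientation: a list `V₁ < ⋯ < Vₙ` of the polygons at a vertex, which stands for the
  cyclic order `V₁ < ⋯ < Vₙ < V₁` -/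
  seq : Γ₀ → List Γ₁
  μ_pos : ∀ α, 0 < μ α
  /-- each polygon occurs at `α` as often as `α` occurs in the polygon -/
  count_seq : ∀ α V, (seq α).count V = (poly V).count α
  /-- every vertex lies in a polygon -/
  exists_poly : ∀ α, ∃ V, α ∈ poly V
  /-- every polygon has at least two vertices -/
  two_le_card : ∀ V, 2 ≤ (poly V).card
  /-- every polygon has a vertex which is not truncated -/
  exists_nontruncated : ∀ V, ∃ α ∈ poly V, 1 < (∑ V', (poly V').count α) * μ α

namespace BrauerConfiguration

attribute [instance] BrauerConfiguration.fin₀ BrauerConfiguration.fin₁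

variable (Γ : BrauerConfiguration.{v})

/-- The valency of a vertex: the number of its occurrences in polygons. -/
def val (α : Γ.Γ₀) : ℕ := ∑ V, (Γ.poly V).count α

/-- An arrow of the quiver of `Γ`: a vertex `α` which is not truncated, together with a
position in the cyclic order of the polygons at `α`. -/
abbrev Arrow : Type v :=
  Σ α : {α : Γ.Γ₀ // 1 < Γ.val α * Γ.μ α}, Fin (Γ.seq α.1).length

/-- The quiver of `Γ`: its vertices are the polygons, and for every vertex `α` of `Γ` which is
not truncated there is an arrow from each entry of the cyclic order at `α` to its
successor. -/
def quiver : FinQuiver.{v} where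
  V := Γ.Γ₁
  E := Γ.Arrow
  s a := (Γ.seq a.1.1).get a.2
  t a := (Γ.seq a.1.1).get
    ⟨(a.2.1 + 1) % (Γ.seq a.1.1).length, Nat.mod_lt _ (Nat.zero_lt_of_lt a.2.2)⟩

/-- The special `α`-cycle which starts at the `i`-th position of the cyclic order
at `α`. -/
def specialCycle (α : {α : Γ.Γ₀ // 1 < Γ.val α * Γ.μ α}) (i : Fin (Γ.seq α.1).length) :
    List Γ.quiver.E :=
  ((List.finRange (Γ.seq α.1).length).rotate i).map (fun j => (⟨α, j⟩ : Γ.Arrow))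

/-- The Brauer configuration algebra of `Γ`: the quotient of the path algebra of the quiver
of `Γ` by the relations given by the powers `C^μ(α)` of the special `α`-cycles `C`. -/
abbrev BCAlgebra (K : Type u) [Field K] : Type (max u v) :=
  QuiverQuotient K Γ.quiver
    (cycleIdeal K {w | ∃ α i, w = cyclePow (Γ.specialCycle α i) (Γ.μ α.1)})

end BrauerConfiguration

/-- `L` is the trivial extension of an almost gentle algebra `A`, which moreover is
indecomposable if `L` is. -/
def IsTrivialExtensionOfAlmostGentle (K : Type u) [Field K] (L : Type (max u v)) [Ring L]
    [Algebra K L] : Prop :=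
  ∃ (A : Type (max u v)) (_ : Ring A) (_ : Algebra K A),
    IsAlmostGentle.{u, v} K A ∧ (IsIndecomposableRing L → IsIndecomposableRing A) ∧
      Nonempty (L ≃ₐ[K] TrivialExtension K A)

end

noncomputable section

open scoped Classical

/-! ### Tools for path algebras -/

/-! As all multiplicities are one, the cycles partition the arrows: every arrow a has a successor
σ(a) with t a = s (σ a), the permutation σ has no fixed point, and the cycles are its orbits, read
from any starting arrow. The main argument uses only such data (`CutCycles`); defining pairs and
Brauer configurations both reduce to it.

Delete one arrow from every orbit and put ab = 0 unless b = σ(a). This quadratic monomial algebra A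
is almost gentle because σ is a permutation. Its basis consists of the trivial paths and the
segments of cycles that avoid the deleted arrows; let p^* be the functional dual to the basis
element p. Let Λ be the algebra defined by the cycles. A basis path p of A has a complement q, for
which pq is a full cycle, and q should correspond to p^*. This dictates φ : Λ → T(A): a kept arrow
goes to itself, a deleted arrow c to the functional of the rest of its cycle. If q = ucv, that rest
is vpu, and u (vpu)^* v = p^* by the bimodule structure (`toTriv_complement`). For trivial p this
shows that all cycles starting at x have the same image, so φ respects the relations
(`ideal_le_ker`).

For bijectivity, let ψ : T(A) → Λ be the linear map that is the natural map on A and sends p^* to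
the complement of p. Then φψ = id, and ψ is surjective: Λ is spanned by vertices and segments of
cycles, a segment shorter than its cycle either avoids the deleted arrow or is the complement of a
path that does, a full cycle is the complement of a trivial path, and longer segments vanish
(`seg_mem_range`). No basis of Λ is needed.

Indecomposability descends to A because a central idempotent e of A yields the central idempotent
(e, 0) of T(A). -/

theorem FinQuiver.isWalk_append_iff {Q : FinQuiver.{v}} {l l' : List Q.E} :
    ∀ {x z : Q.V}, Q.IsWalk x (l ++ l') z ↔ ∃ y, Q.IsWalk x l y ∧ Q.IsWalk y l' z := by
  induction l with
  | nil => intro x z; simp [FinQuiver.IsWalk]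
  | cons a l ih => intro x z; simp [FinQuiver.IsWalk, ih, and_assoc]

namespace PathAlgebra

variable (K : Type u) [Field K] {Q : FinQuiver.{v}}

/-- The idempotent of `KQ` given by a vertex. -/
def vertex (x : Q.V) : PathAlgebra K Q := single K (QPath.trivial x)

@[simp] theorem word_nil : word K ([] : List Q.E) = 1 := rfl

@[simp] theorem word_cons (a : Q.E) (l : List Q.E) : word K (a :: l) = arrow K a * word K l :=
  List.prod_cons

@[simp] theorem word_append (l l' : List Q.E) : word K (l ++ l') = word K l * word K l' := by
  simp [word]

theorem vertex_mul_single (x : Q.V) (p : QPath Q) :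
    vertex K x * single K p = if p.source = x then single K p else 0 := by
  rw [vertex, single_mul_single, pathMul]
  split_ifs with h h' h'
  · congr 1
    ext1
    · exact h'.symm
    · rfl
    · rfl
  · exact absurd (Eq.symm h) h'
  · exact absurd (Eq.symm h') h
  · rfl

theorem single_mul_vertex (p : QPath Q) (x : Q.V) :
    single K p * vertex K x = if p.target = x then single K p else 0 := by
  rw [vertex, single_mul_single, pathMul]
  by_cases h : p.target = x
  · rw [dif_pos (show p.target = (QPath.trivial x).source from h), if_pos h]
    congr 1
    ext1
    · rfl
    · exact List.append_nil _
    · exact h.symm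
  · rw [dif_neg (show ¬ p.target = (QPath.trivial x).source from h), if_neg h]

theorem arrow_mul_single (a : Q.E) (p : QPath Q) :
    arrow K a * single K p =
      if h : p.source = Q.t a then single K ⟨Q.s a, a :: p.arrows, p.target, rfl, h ▸ p.isWalk⟩
      else 0 := by
  rw [arrow, single_mul_single, pathMul]
  by_cases h : p.source = Q.t a
  · rw [dif_pos (show (QPath.ofArrow a).target = p.source from h.symm), dif_pos h]
    rfl
  · rw [dif_neg (show ¬ (QPath.ofArrow a).target = p.source from Ne.symm h), dif_neg h]

theorem single_mul_arrow (p : QPath Q) (a : Q.E) :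
    single K p * arrow K a =
      if h : p.target = Q.s a then
        single K ⟨p.source, p.arrows ++ [a], Q.t a, p.isWalk.append ⟨h.symm, rfl⟩⟩
      else 0 := by
  rw [arrow, single_mul_single, pathMul]
  rfl

theorem vertex_mul_arrow (a : Q.E) : vertex K (Q.s a) * arrow K a = arrow K a :=
  (vertex_mul_single K _ _).trans (if_pos rfl)

theorem arrow_mul_vertex (a : Q.E) : arrow K a * vertex K (Q.t a) = arrow K a :=
  (single_mul_vertex K _ _).trans (if_pos rfl)

theorem single_eq (p : QPath Q) : single K p = vertex K p.source * word K p.arrows := by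
  obtain ⟨x, l, y, h⟩ := p
  induction l generalizing x with
  | nil => cases h; simp; rfl
  | cons a l ih =>
    obtain ⟨rfl, h'⟩ := h
    have h1 : single K ⟨Q.s a, a :: l, y, rfl, h'⟩ = arrow K a * single K ⟨Q.t a, l, y, h'⟩ := by
      rw [arrow_mul_single, dif_pos rfl]
    rw [h1, ih, ← mul_assoc, arrow_mul_vertex, word_cons, ← mul_assoc, vertex_mul_arrow]

theorem word_eq_single {x y : Q.V} {l : List Q.E} (h : Q.IsWalk x l y) (hl : l ≠ []) :
    word K l = single K ⟨x, l, y, h⟩ := by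
  rw [single_eq]
  obtain ⟨a, l, rfl⟩ := List.exists_cons_of_ne_nil hl
  obtain rfl := h.1
  rw [word_cons, ← mul_assoc, vertex_mul_arrow]

theorem arrow_mul_arrow_of_ne {a b : Q.E} (h : Q.t a ≠ Q.s b) : arrow K a * arrow K b = 0 := by
  rw [arrow, arrow, single_mul_single, pathMul,
    dif_neg (show ¬ (QPath.ofArrow a).target = (QPath.ofArrow b).source from h)]

/-- Every path is a vertex times a word in arrows, so multiplicative statements need checking only
on vertices and arrows. -/
theorem generator_induction {P : PathAlgebra K Q → Prop} (x : PathAlgebra K Q)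
    (h0 : P 0) (ha : ∀ x y, P x → P y → P (x + y)) (hc : ∀ (c : K) x, P x → P (c • x))
    (hm : ∀ x y, P x → P y → P (x * y)) (h1 : P 1) (hv : ∀ x, P (vertex K x))
    (har : ∀ a, P (arrow K a)) : P x := by
  refine induction K x h0 (fun p => ?_) ha hc
  rw [single_eq]
  refine hm _ _ (hv _) ?_
  induction p.arrows with
  | nil => exact h1
  | cons a l ih => rw [word_cons]; exact hm _ _ (har a) ih

theorem algHom_ext {B : Type*} [Ring B] [Algebra K B] {f g : PathAlgebra K Q →ₐ[K] B}
    (hv : ∀ x, f (vertex K x) = g (vertex K x)) (ha : ∀ a, f (arrow K a) = g (arrow K a)) :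
    f = g := by
  ext x
  refine generator_induction K (P := fun x => f x = g x) x ?_ ?_ ?_ ?_ ?_ hv ha
  · simp
  · intro x y hx hy; simp [hx, hy]
  · intro c x hx; simp [hx]
  · intro x y hx hy; simp [hx, hy]
  · simp

/-- Elements of a ring which satisfy the relations of the vertices and arrows of a path
algebra. -/
structure IsPathSystem {B : Type*} [Ring B] (e : Q.V → B) (f : Q.E → B) : Prop where
  idem : ∀ x, e x * e x = e x
  orth : ∀ x y, x ≠ y → e x * e y = 0
  sum : ∑ x, e x = 1
  left : ∀ a, e (Q.s a) * f a = f a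
  right : ∀ a, f a * e (Q.t a) = f a

/-- The universal property of the path algebra. -/
def lift {B : Type*} [Ring B] [Algebra K B] {e : Q.V → B} {f : Q.E → B}
    (h : IsPathSystem e f) : PathAlgebra K Q →ₐ[K] B := by
  let φ : PathAlgebra K Q →ₗ[K] B :=
    Finsupp.linearCombination K fun p : QPath Q => e p.source * (p.arrows.map f).prod
  have hφ : ∀ p, φ (single K p) = e p.source * (p.arrows.map f).prod := fun p => by
    refine (Finsupp.linearCombination_single K 1 p).trans (one_smul _ _)
  -- The image of a path absorbs the idempotent of its target. Orthogonality of the idempotents then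
  -- kills products of paths that cannot be composed.
  have hw : ∀ (l : List Q.E) x y, Q.IsWalk x l y →
      e x * (l.map f).prod * e y = e x * (l.map f).prod := by
    intro l
    induction l with
    | nil => rintro x y rfl; simp [h.idem]
    | cons a l ih =>
      rintro x y ⟨rfl, hl⟩
      have := ih _ _ hl
      rw [List.map_cons, List.prod_cons, ← h.right a]
      simp only [mul_assoc] at this ⊢
      rw [this]
  refine AlgHom.ofLinearMap φ ?_ ?_
  · rw [one_def, map_sum, ← h.sum]
    refine Finset.sum_congr rfl fun x _ => ?_
    rw [hφ]
    simp [QPath.trivial]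
  · intro x y
    refine induction K (P := fun x => φ (x * y) = φ x * φ y) x ?_ (fun p => ?_) ?_ ?_
    · simp
    · refine induction K (P := fun y => φ (_ * y) = φ _ * φ y) y ?_ (fun q => ?_) ?_ ?_
      · simp
      · rw [single_mul_single, pathMul, hφ, hφ]
        have := hw _ _ _ p.isWalk
        split_ifs with hpq
        · rw [hφ, ← this, ← hpq]
          simp only [QPath.comp, List.map_append, List.prod_append, ← mul_assoc]
          rw [mul_assoc _ (e p.target) (e p.target), h.idem, this]
        · rw [← this, mul_assoc, ← mul_assoc (e p.target), h.orth _ _ hpq]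
          simp
      · intro y z hy hz; simp [mul_add, hy, hz]
      · intro c y hy; simp [hy]
    · intro y z hy hz; simp [add_mul, hy, hz]
    · intro c y hy; simp [hy]

theorem lift_single {B : Type*} [Ring B] [Algebra K B] {e : Q.V → B} {f : Q.E → B}
    (h : IsPathSystem e f) (p : QPath Q) :
    lift K h (single K p) = e p.source * (p.arrows.map f).prod :=
  (Finsupp.linearCombination_single K 1 p).trans (one_smul _ _)

@[simp] theorem lift_vertex {B : Type*} [Ring B] [Algebra K B] {e : Q.V → B} {f : Q.E → B}
    (h : IsPathSystem e f) (x : Q.V) : lift K h (vertex K x) = e x :=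
  (lift_single K h _).trans (mul_one _)

@[simp] theorem lift_arrow {B : Type*} [Ring B] [Algebra K B] {e : Q.V → B} {f : Q.E → B}
    (h : IsPathSystem e f) (a : Q.E) : lift K h (arrow K a) = f a := by
  rw [arrow, lift_single]
  simp [QPath.ofArrow, h.left]

theorem isPathSystem : IsPathSystem (vertex K : Q.V → PathAlgebra K Q) (arrow K) where
  idem x := (vertex_mul_single K _ _).trans (if_pos rfl)
  orth x y h := by
    have := vertex_mul_single K x (QPath.trivial y)
    rwa [if_neg (show ¬ (QPath.trivial y).source = x from h.symm)] at this
  sum := rfl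
  left := vertex_mul_arrow K
  right := arrow_mul_vertex K

theorem IsPathSystem.map {B C : Type*} [Ring B] [Ring C] {e : Q.V → B} {f : Q.E → B}
    (h : IsPathSystem e f) (φ : B →+* C) : IsPathSystem (fun x => φ (e x)) (fun a => φ (f a)) where
  idem x := by rw [← map_mul, h.idem]
  orth x y hxy := by rw [← map_mul, h.orth x y hxy, map_zero]
  sum := by rw [← map_sum, h.sum, map_one]
  left a := by rw [← map_mul, h.left]
  right a := by rw [← map_mul, h.right]

/-- The coefficient of a path. -/
def coeff (p : QPath Q) : PathAlgebra K Q →ₗ[K] K := Finsupp.lapply p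

theorem coeff_single (p q : QPath Q) : coeff K p (single K q) = if q = p then 1 else 0 :=
  Finsupp.single_apply

theorem coeff_vertex_mul (x : Q.V) (r : QPath Q) (z : PathAlgebra K Q) :
    coeff K r (vertex K x * z) = if r.source = x then coeff K r z else 0 := by
  induction z using PathAlgebra.induction with
  | h0 => simp
  | hs p =>
    rw [vertex_mul_single]
    by_cases h : p = r
    · subst h; split_ifs <;> simp
    · split_ifs <;> simp [coeff_single, h]
  | ha y z hy hz =>
    rw [mul_add, map_add, hy, hz]; split_ifs <;> simp
  | hm c z hz =>
    rw [mul_smul_comm, map_smul, hz]; split_ifs <;> simp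

theorem coeff_mul_vertex (x : Q.V) (r : QPath Q) (z : PathAlgebra K Q) :
    coeff K r (z * vertex K x) = if r.target = x then coeff K r z else 0 := by
  induction z using PathAlgebra.induction with
  | h0 => simp
  | hs p =>
    rw [single_mul_vertex]
    by_cases h : p = r
    · subst h; split_ifs <;> simp
    · split_ifs <;> simp [coeff_single, h]
  | ha y z hy hz =>
    rw [add_mul, map_add, hy, hz]; split_ifs <;> simp
  | hm c z hz =>
    rw [smul_mul_assoc, map_smul, hz]; split_ifs <;> simp

theorem coeff_arrow_mul_nil {x y : Q.V} (h : Q.IsWalk x [] y) (a : Q.E) (z : PathAlgebra K Q) :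
    coeff K ⟨x, [], y, h⟩ (arrow K a * z) = 0 := by
  induction z using PathAlgebra.induction with
  | h0 => simp
  | hs p =>
    rw [arrow_mul_single]
    split_ifs <;> simp [coeff_single, QPath.ext_iff]
  | ha y z hy hz =>
    rw [mul_add, map_add, hy, hz, add_zero]
  | hm c z hz =>
    rw [mul_smul_comm, map_smul, hz, smul_zero]

theorem coeff_mul_arrow_nil {x y : Q.V} (h : Q.IsWalk x [] y) (a : Q.E) (z : PathAlgebra K Q) :
    coeff K ⟨x, [], y, h⟩ (z * arrow K a) = 0 := by
  induction z using PathAlgebra.induction with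
  | h0 => simp
  | hs p =>
    rw [single_mul_arrow]
    split_ifs <;> simp [coeff_single, QPath.ext_iff]
  | ha y z hy hz =>
    rw [add_mul, map_add, hy, hz, add_zero]
  | hm c z hz =>
    rw [smul_mul_assoc, map_smul, hz, smul_zero]

theorem coeff_arrow_mul_cons {x y : Q.V} {b : Q.E} {l : List Q.E} (h : Q.IsWalk x (b :: l) y)
    (a : Q.E) (z : PathAlgebra K Q) :
    coeff K ⟨x, b :: l, y, h⟩ (arrow K a * z) =
      if a = b then coeff K ⟨Q.t b, l, y, h.2⟩ z else 0 := by
  induction z using PathAlgebra.induction with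
  | h0 => simp
  | hs p =>
    obtain ⟨rfl, h'⟩ := h
    obtain ⟨x', l', y', h''⟩ := p
    rw [arrow_mul_single]
    by_cases hab : a = b
    · subst hab
      by_cases hx : x' = Q.t a
      · subst hx; simp [coeff_single, QPath.ext_iff]
      · simp [coeff_single, QPath.ext_iff, hx]
    · split_ifs <;> simp [coeff_single, QPath.ext_iff, hab]
  | ha y z hy hz =>
    rw [mul_add, map_add, hy, hz]; split_ifs <;> simp
  | hm c z hz =>
    rw [mul_smul_comm, map_smul, hz]; split_ifs <;> simp

theorem coeff_mul_arrow_concat {x y w : Q.V} {b : Q.E} {l : List Q.E}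
    (h : Q.IsWalk x (l ++ [b]) y) (h' : Q.IsWalk x l w) (a : Q.E) (z : PathAlgebra K Q) :
    coeff K ⟨x, l ++ [b], y, h⟩ (z * arrow K a) =
      if a = b then coeff K ⟨x, l, w, h'⟩ z else 0 := by
  have hw : ∀ {l : List Q.E} {x y z : Q.V}, Q.IsWalk x l y → Q.IsWalk x l z → y = z := by
    intro l
    induction l with
    | nil => rintro x y z rfl h; exact h
    | cons a l ih => intro x y z h h'; exact ih h.2 h'.2
  induction z using PathAlgebra.induction with
  | h0 => simp
  | hs p =>
    obtain ⟨w', hw1, hw2, rfl⟩ := FinQuiver.isWalk_append_iff.1 h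
    obtain rfl := hw hw1 h'
    obtain ⟨x', l', y', h''⟩ := p
    rw [single_mul_arrow]
    by_cases hab : a = b
    · subst hab
      by_cases hx : y' = w'
      · subst hx; simp [coeff_single, hw2]
      · simp [coeff_single, hx, hw2]
    · split_ifs <;> simp [coeff_single, hab]
  | ha y z hy hz =>
    rw [add_mul, map_add, hy, hz]; split_ifs <;> simp
  | hm c z hz =>
    rw [smul_mul_assoc, map_smul, hz]; split_ifs <;> simp

theorem coeff_arrow_mul_of_head?_ne {p : QPath Q} {a : Q.E} (h : p.arrows.head? ≠ some a)
    (z : PathAlgebra K Q) : coeff K p (arrow K a * z) = 0 := by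
  obtain ⟨x, l, y, hw⟩ := p
  cases l with
  | nil => exact coeff_arrow_mul_nil K hw a z
  | cons b l => exact (coeff_arrow_mul_cons K hw a z).trans (if_neg fun hab => h (by simp [hab]))

theorem coeff_mul_arrow_of_getLast?_ne {p : QPath Q} {a : Q.E}
    (h : p.arrows.getLast? ≠ some a) (z : PathAlgebra K Q) : coeff K p (z * arrow K a) = 0 := by
  obtain ⟨x, l, y, hw⟩ := p
  rcases List.eq_nil_or_concat' l with rfl | ⟨l, b, rfl⟩
  · exact coeff_mul_arrow_nil K hw a z
  · obtain ⟨w, hw', -⟩ := FinQuiver.isWalk_append_iff.1 hw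
    exact (coeff_mul_arrow_concat K hw hw' a z).trans (if_neg fun hab => h (by simp [hab]))

/-- Prefixing a fixed path is injective on paths. Together with `coeff_mul_word` this turns the
functional of vpu, evaluated at vzu, into the functional of p at z. -/
theorem coeff_word_mul {x y w : Q.V} {l m : List Q.E} (h : Q.IsWalk x (l ++ m) y)
    (hl : Q.IsWalk x l w) (hm : Q.IsWalk w m y) (z : PathAlgebra K Q) :
    coeff K ⟨x, l ++ m, y, h⟩ (word K l * z) = coeff K ⟨w, m, y, hm⟩ z := by
  induction l generalizing x with
  | nil => cases hl; simp
  | cons a l ih =>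
    rw [word_cons, mul_assoc]
    refine (coeff_arrow_mul_cons K h a _).trans ?_
    rw [if_pos rfl]
    exact ih _ hl.2

theorem coeff_mul_word {x y w : Q.V} {l m : List Q.E} (h : Q.IsWalk x (l ++ m) y)
    (hl : Q.IsWalk x l w) (hm : Q.IsWalk w m y) (z : PathAlgebra K Q) :
    coeff K ⟨x, l ++ m, y, h⟩ (z * word K m) = coeff K ⟨x, l, w, hl⟩ z := by
  induction m generalizing l w z with
  | nil => cases hm; simp
  | cons b m ih =>
    obtain ⟨rfl, hm⟩ := hm
    have h1 : Q.IsWalk x (l ++ [b]) (Q.t b) := hl.append ⟨rfl, rfl⟩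
    have h2 : Q.IsWalk x ((l ++ [b]) ++ m) y := by simpa using h
    have := ih h2 h1 hm (z * arrow K b)
    rw [coeff_mul_arrow_concat K h1 hl, if_pos rfl] at this
    rw [word_cons, ← mul_assoc, ← this]
    simp

/-- A list that is not a chain contains two consecutive unrelated arrows. This serves both for the
monomial ideal and for the ideal of the cycles. -/
theorem word_mem_of_not_isChain {I : TwoSidedIdeal (PathAlgebra K Q)} {r : Q.E → Q.E → Prop}
    (h : ∀ a b, ¬ r a b → word K [a, b] ∈ I) :
    ∀ l : List Q.E, ¬ l.IsChain r → word K l ∈ I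
  | [], hl => absurd .nil hl
  | [a], hl => absurd (.singleton a) hl
  | a :: b :: l, hl => by
    by_cases hab : r a b
    · rw [word_cons]
      exact I.mul_mem_left _ _ (word_mem_of_not_isChain h _
        fun h' => hl (List.isChain_cons_cons.2 ⟨hab, h'⟩))
    · have := I.mul_mem_right _ (word K l) (h a b hab)
      rwa [← word_append] at this

end PathAlgebra

/-! ### Quotients of path algebras -/

namespace QuiverQuotient

variable {K : Type u} [Field K] {Q : FinQuiver.{v}} (I : TwoSidedIdeal (PathAlgebra K Q))

/-- The projection `KQ → KQ/I`. -/
def mk : PathAlgebra K Q →ₐ[K] QuiverQuotient K Q I := I.ringCon.mkₐ K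

theorem mk_surjective : Function.Surjective (mk I) := I.ringCon.mk'_surjective

theorem mk_eq_zero {x : PathAlgebra K Q} : mk I x = 0 ↔ x ∈ I := by
  have := I.ringCon.eq (a := x) (b := 0)
  rw [I.mem_iff]
  exact this

/-- The linear map on `KQ/I` given by a linear map which vanishes on `I`. -/
def liftLinear {M : Type*} [AddCommGroup M] [Module K M] (φ : PathAlgebra K Q →ₗ[K] M)
    (h : ∀ x ∈ I, φ x = 0) : QuiverQuotient K Q I →ₗ[K] M where
  toFun x := Quotient.liftOn' x φ fun a b hab => by
    rw [← sub_eq_zero, ← map_sub]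
    exact h _ ((I.rel_iff a b).1 hab)
  map_add' x y := by
    obtain ⟨x, rfl⟩ := mk_surjective I x
    obtain ⟨y, rfl⟩ := mk_surjective I y
    exact φ.map_add x y
  map_smul' c x := by
    obtain ⟨x, rfl⟩ := mk_surjective I x
    exact φ.map_smul c x

/-- The homomorphism on `KQ/I` given by a homomorphism which vanishes on `I`. -/
def lift {B : Type*} [Ring B] [Algebra K B] (φ : PathAlgebra K Q →ₐ[K] B)
    (h : I ≤ TwoSidedIdeal.ker φ) : QuiverQuotient K Q I →ₐ[K] B :=
  I.ringCon.liftₐ φ fun _ _ hab => TwoSidedIdeal.ringCon_le_iff.1 h hab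

end QuiverQuotient

/-! ### Quadratic monomial algebras -/

/-- The ideal generated by the paths `ab` of length two such that `r a b` does not hold. -/
def monomialIdeal (K : Type u) [Field K] {Q : FinQuiver.{v}} (r : Q.E → Q.E → Prop) :
    TwoSidedIdeal (PathAlgebra K Q) :=
  TwoSidedIdeal.span (PathAlgebra.single K '' {p | ∃ a b, p.arrows = [a, b] ∧ ¬ r a b})

namespace monomialIdeal

open PathAlgebra

variable {K : Type u} [Field K] {Q : FinQuiver.{v}} {r : Q.E → Q.E → Prop}

theorem isGeneratedByLengthTwoPaths : IsGeneratedByLengthTwoPaths (monomialIdeal K r) := by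
  refine ⟨_, ?_, rfl⟩
  rintro p ⟨a, b, h, -⟩
  simp [QPath.length, h]

theorem word_pair_mem {a b : Q.E} (h : ¬ r a b) : word K [a, b] ∈ monomialIdeal K r := by
  by_cases hab : Q.t a = Q.s b
  · have hw : Q.IsWalk (Q.s a) [a, b] (Q.t b) := ⟨rfl, hab.symm, rfl⟩
    rw [word_eq_single K hw (by simp)]
    exact TwoSidedIdeal.subset_span ⟨_, ⟨a, b, rfl, h⟩, rfl⟩
  · have : word K [a, b] = 0 := by simp [arrow_mul_arrow_of_ne K hab]
    rw [this]
    exact zero_mem _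

theorem single_mem {p : QPath Q} (h : ¬ p.arrows.IsChain r) : single K p ∈ monomialIdeal K r := by
  rw [single_eq]
  exact TwoSidedIdeal.mul_mem_left _ _ _
    (word_mem_of_not_isChain K (fun _ _ => word_pair_mem) _ h)

/-- Final pieces of a chain are chains, so elements without chain coefficients are stable under left
multiplication; `coeff_mul_right` uses initial pieces. -/
theorem coeff_mul_left {y : PathAlgebra K Q}
    (hy : ∀ p : QPath Q, p.arrows.IsChain r → coeff K p y = 0) (x : PathAlgebra K Q) :
    ∀ p : QPath Q, p.arrows.IsChain r → coeff K p (x * y) = 0 := by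
  -- The element is generalized because the product case of the induction applies the hypothesis for
  -- one factor to a multiple of `y`.
  suffices H : ∀ y : PathAlgebra K Q, (∀ p : QPath Q, p.arrows.IsChain r → coeff K p y = 0) →
      ∀ p : QPath Q, p.arrows.IsChain r → coeff K p (x * y) = 0 from H y hy
  refine generator_induction K (P := fun x => ∀ y : PathAlgebra K Q,
    (∀ p : QPath Q, p.arrows.IsChain r → coeff K p y = 0) →
      ∀ p : QPath Q, p.arrows.IsChain r → coeff K p (x * y) = 0) x ?_ ?_ ?_ ?_ ?_ ?_ ?_
  · intro y _ p _; simp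
  · intro x x' h h' y hy p hp; rw [add_mul, map_add, h y hy p hp, h' y hy p hp, add_zero]
  · intro c x h y hy p hp; rw [smul_mul_assoc, map_smul, h y hy p hp, smul_zero]
  · intro x x' h h' y hy p hp; rw [mul_assoc]; exact h _ (h' y hy) p hp
  · intro y hy p hp; rw [one_mul]; exact hy p hp
  · intro x y hy p hp; rw [coeff_vertex_mul, hy p hp, ite_self]
  · rintro a y hy ⟨x, l, z, h⟩ hp
    cases l with
    | nil => exact coeff_arrow_mul_nil K h a y
    | cons b l =>
      rw [coeff_arrow_mul_cons, hy _ (List.IsChain.tail hp), ite_self]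

theorem coeff_mul_right {y : PathAlgebra K Q}
    (hy : ∀ p : QPath Q, p.arrows.IsChain r → coeff K p y = 0) (x : PathAlgebra K Q) :
    ∀ p : QPath Q, p.arrows.IsChain r → coeff K p (y * x) = 0 := by
  suffices H : ∀ y : PathAlgebra K Q, (∀ p : QPath Q, p.arrows.IsChain r → coeff K p y = 0) →
      ∀ p : QPath Q, p.arrows.IsChain r → coeff K p (y * x) = 0 from H y hy
  refine generator_induction K (P := fun x => ∀ y : PathAlgebra K Q,
    (∀ p : QPath Q, p.arrows.IsChain r → coeff K p y = 0) →
      ∀ p : QPath Q, p.arrows.IsChain r → coeff K p (y * x) = 0) x ?_ ?_ ?_ ?_ ?_ ?_ ?_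
  · intro y _ p _; simp
  · intro x x' h h' y hy p hp; rw [mul_add, map_add, h y hy p hp, h' y hy p hp, add_zero]
  · intro c x h y hy p hp; rw [mul_smul_comm, map_smul, h y hy p hp, smul_zero]
  · intro x x' h h' y hy p hp; rw [← mul_assoc]; exact h' _ (h y hy) p hp
  · intro y hy p hp; rw [mul_one]; exact hy p hp
  · intro x y hy p hp; rw [coeff_mul_vertex, hy p hp, ite_self]
  · rintro a y hy ⟨x, l, z, h⟩ hp
    rcases List.eq_nil_or_concat' l with rfl | ⟨l, b, rfl⟩
    · exact coeff_mul_arrow_nil K h a y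
    · obtain ⟨w, hw, -⟩ := FinQuiver.isWalk_append_iff.1 h
      rw [coeff_mul_arrow_concat K h hw, hy _ (List.IsChain.left_of_append hp), ite_self]

theorem coeff_eq_zero {x : PathAlgebra K Q} (hx : x ∈ monomialIdeal K r) :
    ∀ p : QPath Q, p.arrows.IsChain r → coeff K p x = 0 := by
  refine TwoSidedIdeal.span_induction (p := fun x _ => ∀ p : QPath Q, p.arrows.IsChain r →
    coeff K p x = 0) ?_ ?_ ?_ ?_ ?_ ?_ hx
  · rintro _ ⟨q, ⟨a, b, hq, hab⟩, rfl⟩ p hp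
    rw [coeff_single, if_neg]
    rintro rfl
    rw [hq] at hp
    exact hab (List.isChain_pair.1 hp)
  · intro p _; simp
  · intro x y _ _ hx hy p hp; rw [map_add, hx p hp, hy p hp, add_zero]
  · intro x _ hx p hp; rw [map_neg, hx p hp, neg_zero]
  · intro a x _ hx; exact coeff_mul_left hx a
  · intro a x _ hx; exact coeff_mul_right hx a

theorem isAdmissible {N : ℕ} (hN : ∀ p : QPath Q, p.arrows.IsChain r → p.length < N) :
    IsAdmissible (monomialIdeal K r) := by
  refine ⟨fun x hx p hp => ?_, N, fun p hp => single_mem fun h => (hN p h).not_ge hp⟩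
  -- A path of length at most one is trivially a chain, so its coefficient vanishes on the ideal.
  by_contra hlt
  refine (Finsupp.mem_support_iff (M := K) (f := x)).1 hp (coeff_eq_zero hx p ?_)
  rw [QPath.length] at hlt
  match h : p.arrows with
  | [] => exact .nil
  | [a] => exact .singleton a
  | a :: b :: l => simp [h] at hlt

theorem isSpecialMultiserialIdeal (h : ∀ a b b', r a b → r a b' → b = b')
    (h' : ∀ a c c', r c a → r c' a → c = c') : IsSpecialMultiserialIdeal (monomialIdeal K r) := by
  have key : ∀ a b, arrow K a * arrow K b ∉ monomialIdeal K r → r a b := by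
    intro a b hab
    by_contra hr
    exact hab (by simpa using word_pair_mem (K := K) hr)
  exact fun a => ⟨fun b b' hb hb' => h a b b' (key _ _ hb) (key _ _ hb'),
    fun c c' hc hc' => h' a c c' (key _ _ hc) (key _ _ hc')⟩

variable (K)

/-- The quotient of `KQ` by `monomialIdeal K r`. -/
abbrev Alg (r : Q.E → Q.E → Prop) := QuiverQuotient K Q (monomialIdeal K r)

/-- The paths which are nonzero in the quotient by `monomialIdeal K r`. -/
abbrev NonzeroPath (r : Q.E → Q.E → Prop) := {p : QPath Q // p.arrows.IsChain r}

/-- The coefficient of a nonzero path, as a functional on the quotient. -/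
def coord (p : NonzeroPath r) : Alg K r →ₗ[K] K :=
  QuiverQuotient.liftLinear _ (coeff K p.1) fun _ hx => coeff_eq_zero hx p.1 p.2

@[simp] theorem coord_mk (p : NonzeroPath r) (x : PathAlgebra K Q) :
    coord K p (QuiverQuotient.mk _ x) = coeff K p.1 x := rfl

variable (r)

/-- The basis of the quotient given by the nonzero paths. -/
def basis : Module.Basis (NonzeroPath r) K (Alg K r) :=
  Module.Basis.mk (v := fun p => QuiverQuotient.mk _ (single K p.1))
    (by
      rw [linearIndependent_iff']
      intro s g hg p hp
      -- The coordinate functionals are dual to the paths, so applying one of them isolates a single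
      -- coefficient.
      have := congrArg (coord K p) hg
      rw [map_sum, map_zero] at this
      rw [← this, Finset.sum_eq_single p]
      · simp [coeff_single]
      · intro q _ hq
        rw [map_smul, coord_mk, coeff_single, if_neg (fun h => hq (Subtype.ext h)), smul_zero]
      · exact fun h => absurd hp h)
    (by
      rintro x -
      obtain ⟨x, rfl⟩ := QuiverQuotient.mk_surjective _ x
      induction x using PathAlgebra.induction with
      | h0 => rw [map_zero]; exact zero_mem _
      | ha x y hx hy => rw [map_add]; exact add_mem hx hy
      | hm c x hx => rw [map_smul]; exact Submodule.smul_mem _ c hx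
      | hs p =>
        by_cases hp : p.arrows.IsChain r
        · exact Submodule.subset_span ⟨⟨p, hp⟩, rfl⟩
        · rw [(QuiverQuotient.mk_eq_zero _).2 (single_mem hp)]
          exact zero_mem _)

@[simp] theorem basis_apply (p : NonzeroPath r) :
    basis K r p = QuiverQuotient.mk _ (single K p.1) := by
  simp [basis]

theorem coord_basis (p q : NonzeroPath r) :
    coord K p (basis K r q) = if q = p then 1 else 0 := by
  simp [coeff_single, Subtype.ext_iff]

end monomialIdeal

/-! ### Quivers which are disjoint unions of cycles -/

/-- A permutation `next` of the arrows of `Q` with `t a = s (next a)`, without fixed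
points, together with a set of arrows which contains exactly one arrow of every orbit. Its
orbits are cycles which together contain every arrow once. -/
structure CutCycles (Q : FinQuiver.{v}) where
  next : Equiv.Perm Q.E
  s_next : ∀ a, Q.s (next a) = Q.t a
  next_ne : ∀ a, next a ≠ a
  exists_s_eq : ∀ x, ∃ a, Q.s a = x
  cut : Set Q.E
  exists_cut : ∀ a, ∃ i < Function.minimalPeriod next a, next^[i] a ∈ cut
  cut_unique : ∀ a, ∀ i < Function.minimalPeriod next a, ∀ j < Function.minimalPeriod next a,
    next^[i] a ∈ cut → next^[j] a ∈ cut → i = j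

namespace CutCycles

open PathAlgebra

variable {Q : FinQuiver.{v}} (C : CutCycles Q)

/-- The length of the cycle of an arrow. -/
def per (a : Q.E) : ℕ := Function.minimalPeriod C.next a

/-- The path of length `k` along the cycle of `a` which starts with `a`. -/
def seg (a : Q.E) (k : ℕ) : List Q.E := List.iterate C.next a k

theorem per_pos (a : Q.E) : 0 < C.per a := by
  obtain ⟨i, hi, -⟩ := C.exists_cut a
  exact Nat.zero_lt_of_lt hi

theorem next_per (a : Q.E) : C.next^[C.per a] a = a := Function.iterate_minimalPeriod

theorem per_iterate (a : Q.E) (k : ℕ) : C.per (C.next^[k] a) = C.per a :=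
  Function.minimalPeriod_apply_iterate
    (Function.minimalPeriod_pos_iff_mem_periodicPts.1 (C.per_pos a)) k

theorem seg_add (a : Q.E) (k l : ℕ) : C.seg a (k + l) = C.seg a k ++ C.seg (C.next^[k] a) l :=
  List.iterate_add _ _ _ _

theorem seg_succ (a : Q.E) (k : ℕ) : C.seg a (k + 1) = a :: C.seg (C.next a) k := rfl

@[simp] theorem length_seg (a : Q.E) (k : ℕ) : (C.seg a k).length = k := List.length_iterate ..

theorem mem_seg {a b : Q.E} {k : ℕ} : b ∈ C.seg a k ↔ ∃ m < k, b = C.next^[m] a :=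
  List.mem_iterate

theorem isWalk_seg (a : Q.E) (k : ℕ) : Q.IsWalk (Q.s a) (C.seg a k) (Q.s (C.next^[k] a)) := by
  induction k generalizing a with
  | zero => exact rfl
  | succ k ih =>
    refine ⟨rfl, ?_⟩
    rw [← C.s_next]
    exact ih (C.next a)

theorem isChain_seg (a : Q.E) (k : ℕ) : (C.seg a k).IsChain (fun a b => b = C.next a) := by
  induction k generalizing a with
  | zero => exact .nil
  | succ k ih =>
    cases k with
    | zero => exact .singleton a
    | succ k => exact List.isChain_cons_cons.2 ⟨rfl, ih (C.next a)⟩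

theorem eq_seg_of_isChain {a : Q.E} {l : List Q.E}
    (h : (a :: l).IsChain (fun a b => b = C.next a)) : a :: l = C.seg a (l.length + 1) := by
  induction l generalizing a with
  | nil => rfl
  | cons b l ih =>
    obtain ⟨rfl, h⟩ := List.isChain_cons_cons.1 h
    rw [ih h]
    simp [seg_succ]

/-- One full turn always meets a cut arrow. -/
theorem lt_per {a : Q.E} {k : ℕ} (h : ∀ i < k, C.next^[i] a ∉ C.cut) : k < C.per a := by
  obtain ⟨i, hi, hc⟩ := C.exists_cut a
  by_contra hk
  exact h i (lt_of_lt_of_le hi (not_lt.1 hk)) hc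

/-- The quiver obtained by deleting the arrows in `C.cut`. -/
def sub : FinQuiver.{v} where
  V := Q.V
  E := {a : Q.E // a ∉ C.cut}
  s a := Q.s a.1
  t a := Q.t a.1

/-- The inclusion of the arrows of `C.sub`. -/
def val (a : C.sub.E) : Q.E := Subtype.val a

theorem val_injective : Function.Injective C.val := Subtype.val_injective

theorem val_notMem (a : C.sub.E) : C.val a ∉ C.cut := Subtype.property a

theorem exists_map_val_eq {l : List Q.E} (h : ∀ a ∈ l, a ∉ C.cut) :
    ∃ l' : List C.sub.E, l'.map C.val = l := by
  lift l to List {a : Q.E // a ∉ C.cut} using h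
  exact ⟨l, rfl⟩

/-- The relation between consecutive arrows of the cycles. -/
def rel (a b : C.sub.E) : Prop := C.val b = C.next (C.val a)

theorem isWalk_sub {x y : Q.V} {l : List C.sub.E} :
    C.sub.IsWalk x l y ↔ Q.IsWalk x (l.map C.val) y := by
  induction l generalizing x with
  | nil => exact Iff.rfl
  | cons a l ih => exact and_congr Iff.rfl ih

theorem isChain_sub {l : List C.sub.E} :
    l.IsChain C.rel ↔ (l.map C.val).IsChain (fun a b => b = C.next a) :=
  (List.isChain_map (R := fun a b => b = C.next a) C.val).symm

theorem exists_map_val_eq_seg {a : Q.E} {k : ℕ} (h : ∀ i < k, C.next^[i] a ∉ C.cut) :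
    ∃ l : List C.sub.E, l.map C.val = C.seg a k :=
  C.exists_map_val_eq fun b hb => by
    obtain ⟨i, hi, rfl⟩ := C.mem_seg.1 hb
    exact h i hi

/-- A segment without cut arrows, as a path in `C.sub`. -/
def segPath (a : Q.E) (k : ℕ) (h : ∀ i < k, C.next^[i] a ∉ C.cut) :
    monomialIdeal.NonzeroPath C.rel :=
  have H := C.exists_map_val_eq_seg h
  ⟨{ source := Q.s a
     arrows := H.choose
     target := Q.s (C.next^[k] a)
     isWalk := C.isWalk_sub.2 (H.choose_spec.symm ▸ C.isWalk_seg a k) },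
    C.isChain_sub.2 (H.choose_spec.symm ▸ C.isChain_seg a k)⟩

@[simp] theorem map_segPath (a : Q.E) (k : ℕ) (h : ∀ i < k, C.next^[i] a ∉ C.cut) :
    (C.segPath a k h).1.arrows.map C.val = C.seg a k :=
  (C.exists_map_val_eq_seg h).choose_spec

theorem nonzeroPath_ext {p q : monomialIdeal.NonzeroPath C.rel} (hs : p.1.source = q.1.source)
    (ha : p.1.arrows.map C.val = q.1.arrows.map C.val) : p = q := by
  have ha := List.map_injective_iff.2 C.val_injective ha
  refine Subtype.ext (QPath.ext hs ha ?_)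
  have hp := p.1.isWalk
  have hq := q.1.isWalk
  rw [hs, ha] at hp
  have hw : ∀ {l : List C.sub.E} {x y z : Q.V},
      C.sub.IsWalk x l y → C.sub.IsWalk x l z → y = z := by
    intro l
    induction l with
    | nil => rintro x y z rfl h; exact h
    | cons a l ih => intro x y z h h'; exact ih h.2 h'.2
  exact hw hp hq

/-- A nontrivial chain follows its first arrow along the cycle. A trivial path is a segment of
length zero at any arrow starting there; this needs `exists_s_eq`, and the arrow is not unique. -/
theorem exists_eq_segPath (p : monomialIdeal.NonzeroPath C.rel) :
    ∃ (a : Q.E) (h : ∀ i < p.1.length, C.next^[i] a ∉ C.cut), p = C.segPath a p.1.length h := by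
  suffices H : ∃ a : Q.E, Q.s a = p.1.source ∧
      p.1.arrows.map C.val = C.seg a p.1.length by
    obtain ⟨a, hs, ha⟩ := H
    have h : ∀ i < p.1.length, C.next^[i] a ∉ C.cut := by
      intro i hi
      have : C.next^[i] a ∈ p.1.arrows.map C.val := by
        rw [ha]; exact C.mem_seg.2 ⟨i, hi, rfl⟩
      obtain ⟨b, -, hb⟩ := List.mem_map.1 this
      exact hb ▸ C.val_notMem b
    exact ⟨a, h, C.nonzeroPath_ext (q := C.segPath a _ h) hs.symm (by rw [ha, map_segPath])⟩
  obtain ⟨⟨x, l, y, hw⟩, hc⟩ := p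
  cases l with
  | nil =>
    obtain ⟨a, ha⟩ := C.exists_s_eq x
    exact ⟨a, ha, rfl⟩
  | cons b l =>
    refine ⟨C.val b, hw.1, (C.eq_seg_of_isChain (C.isChain_sub.1 hc)).trans ?_⟩
    simp [QPath.length]

/-- The sum of all periods is a crude bound, but it does not depend on the path, which is what
admissibility and finiteness of the basis require. -/
theorem length_lt (p : monomialIdeal.NonzeroPath C.rel) : p.1.length < ∑ a, C.per a + 1 := by
  obtain ⟨a, h, -⟩ := C.exists_eq_segPath p
  exact (C.lt_per h).trans_le
    ((Finset.single_le_sum (fun _ _ => Nat.zero_le _) (Finset.mem_univ a)).trans (Nat.le_succ _))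

instance finite_nonzeroPath : Finite (monomialIdeal.NonzeroPath C.rel) := by
  have := (List.finite_length_lt C.sub.E (∑ a, C.per a + 1)).to_subtype
  have : Finite (C.sub.V × C.sub.V × {l : List C.sub.E | l.length < ∑ a, C.per a + 1}) :=
    inferInstance
  refine Finite.of_injective
    (β := C.sub.V × C.sub.V × {l : List C.sub.E | l.length < ∑ a, C.per a + 1})
    (fun p => (p.1.source, p.1.target, ⟨p.1.arrows, C.length_lt p⟩)) fun p q h => ?_
  simp only [Prod.mk.injEq] at h
  exact Subtype.ext (QPath.ext h.1 (congrArg Subtype.val h.2.2) h.2.1)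

variable (K : Type u) [Field K]

/-- The quotient of the path algebra of `C.sub` by the paths of length two which are not
contained in the cycles. -/
abbrev subAlg := monomialIdeal.Alg K C.rel

/-- Successors are unique because `next` is a function, predecessors because it is injective. -/
theorem isAlmostGentle_subAlg : IsAlmostGentle.{u, v} K (C.subAlg K) :=
  ⟨C.sub, monomialIdeal K C.rel,
    monomialIdeal.isAdmissible fun p hp => C.length_lt ⟨p, hp⟩,
    monomialIdeal.isGeneratedByLengthTwoPaths,
    monomialIdeal.isSpecialMultiserialIdeal
      (fun _ _ _ h h' => Subtype.ext (h.trans h'.symm))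
      (fun _ _ _ h h' => Subtype.ext (C.next.injective (h.symm.trans h'))),
    IsMoritaEquivalent.refl _ _⟩

end CutCycles

/-! ### The homomorphism from the path algebra to the trivial extension -/

namespace CutCycles

open PathAlgebra monomialIdeal TrivSqZeroExt

variable {Q : FinQuiver.{v}} (C : CutCycles Q)

theorem cutPath_uncut (c : Q.E) (hc : c ∈ C.cut) :
    ∀ i < C.per c - 1, C.next^[i] (C.next c) ∉ C.cut := fun i hi h => by
  have := C.cut_unique c (i + 1) (Nat.add_lt_of_lt_sub hi) 0 (C.per_pos c) h hc
  omega

/-- The rest of the cycle of a cut arrow. -/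
def cutPath (c : Q.E) (hc : c ∈ C.cut) : NonzeroPath C.rel :=
  C.segPath (C.next c) (C.per c - 1) (C.cutPath_uncut c hc)

theorem source_cutPath (c : Q.E) (hc : c ∈ C.cut) : (C.cutPath c hc).1.source = Q.t c :=
  C.s_next c

theorem target_cutPath (c : Q.E) (hc : c ∈ C.cut) : (C.cutPath c hc).1.target = Q.s c := by
  refine congrArg Q.s (?_ : C.next^[C.per c - 1] (C.next c) = c)
  rw [← Function.iterate_succ_apply, Nat.succ_eq_add_one, Nat.sub_add_cancel (C.per_pos c),
    C.next_per]

variable (K : Type u) [Field K]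

/-- The projection onto `C.subAlg K`. -/
abbrev proj : PathAlgebra K C.sub →ₐ[K] C.subAlg K := QuiverQuotient.mk _

/-- The functional on `C.subAlg K` given by a path. -/
def dual (p : NonzeroPath C.rel) : DualBimodule K (C.subAlg K) := coord K p

theorem dual_proj (p : NonzeroPath C.rel) (z : PathAlgebra K C.sub) :
    C.dual K p (C.proj K z) = coeff K p.1 z := rfl

theorem dual_ext {f g : DualBimodule K (C.subAlg K)}
    (h : ∀ z, f (C.proj K z) = g (C.proj K z)) : f = g :=
  DualBimodule.ext fun x => by
    obtain ⟨z, rfl⟩ := QuiverQuotient.mk_surjective _ x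
    exact h z

/-- The image in the trivial extension of an arrow. -/
def arrowImage (a : Q.E) : TrivialExtension K (C.subAlg K) :=
  if h : a ∈ C.cut then inr (C.dual K (C.cutPath a h))
  else inl (C.proj K (arrow K (Q := C.sub) ⟨a, h⟩))

/-- The image in the trivial extension of a vertex. -/
def vertexImage (x : Q.V) : TrivialExtension K (C.subAlg K) :=
  inl (C.proj K (vertex K (Q := C.sub) x))

theorem arrowImage_cut {a : Q.E} (h : a ∈ C.cut) :
    C.arrowImage K a = inr (C.dual K (C.cutPath a h)) := dif_pos h

theorem arrowImage_val (a : C.sub.E) :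
    C.arrowImage K (C.val a) = inl (C.proj K (arrow K a)) := dif_neg (C.val_notMem a)

theorem exists_val_eq {a : Q.E} (h : a ∉ C.cut) : ∃ b, C.val b = a := ⟨⟨a, h⟩, rfl⟩

/-- The bimodule structure on the dual exchanges the two ends of a path: the left action of a vertex
tests the target, the right action the source. The rest of the cycle of a cut arrow c runs from t c
to s c, so its functional behaves like an arrow from s c to t c. -/
theorem isPathSystem_image : IsPathSystem (C.vertexImage K) (C.arrowImage K) := by
  have H := ((PathAlgebra.isPathSystem K (Q := C.sub)).map (C.proj K).toRingHom).map
    (inlHom (C.subAlg K) (DualBimodule K (C.subAlg K)))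
  refine ⟨H.idem, H.orth, H.sum, fun a => ?_, fun a => ?_⟩
  · by_cases h : a ∈ C.cut
    · rw [C.arrowImage_cut K h, vertexImage, inl_mul_inr]
      congr 1
      refine C.dual_ext K fun z => ?_
      rw [DualBimodule.smul_apply, ← map_mul, dual_proj, dual_proj]
      exact (coeff_mul_vertex K (Q := C.sub) _ _ _).trans (if_pos (C.target_cutPath a h))
    · obtain ⟨b, rfl⟩ := C.exists_val_eq h
      rw [arrowImage_val]
      exact H.left b
  · by_cases h : a ∈ C.cut
    · rw [C.arrowImage_cut K h, vertexImage, inr_mul_inl]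
      congr 1
      refine C.dual_ext K fun z => ?_
      rw [DualBimodule.op_smul_apply, ← map_mul, dual_proj, dual_proj]
      exact (coeff_vertex_mul K (Q := C.sub) _ _ _).trans (if_pos (C.source_cutPath a h))
    · obtain ⟨b, rfl⟩ := C.exists_val_eq h
      rw [arrowImage_val]
      exact H.right b

/-- The homomorphism from the path algebra to the trivial extension. -/
def toTriv : PathAlgebra K Q →ₐ[K] TrivialExtension K (C.subAlg K) :=
  PathAlgebra.lift K (C.isPathSystem_image K)

theorem toTriv_arrow (a : Q.E) : C.toTriv K (arrow K a) = C.arrowImage K a := lift_arrow K _ a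

theorem toTriv_vertex (x : Q.V) : C.toTriv K (vertex K x) = C.vertexImage K x := lift_vertex K _ x

theorem toTriv_word_map (l : List C.sub.E) :
    C.toTriv K (word K (l.map C.val)) = inl (C.proj K (word K l)) := by
  induction l with
  | nil => simp
  | cons a l ih =>
    rw [List.map_cons, word_cons, word_cons, map_mul, ih, toTriv_arrow, arrowImage_val, map_mul,
      inl_mul]

/-- The complement of a segment without cut arrows in its cycle is mapped to the functional
given by the segment. -/
theorem toTriv_complement (a : Q.E) (k : ℕ) (h : ∀ i < k, C.next^[i] a ∉ C.cut) :
    C.toTriv K (word K (C.seg (C.next^[k] a) (C.per a - k))) = inr (C.dual K (C.segPath a k h)) := by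
  obtain ⟨i, hi, hc⟩ := C.exists_cut a
  have hki : k ≤ i := by
    by_contra hki
    exact h i (not_le.1 hki) hc
  have hiter : ∀ m n, C.next^[m] (C.next^[n] a) = C.next^[m + n] a := fun m n =>
    (Function.iterate_add_apply _ m n a).symm
  obtain ⟨j, rfl⟩ := Nat.exists_eq_add_of_le hki
  have hper : C.per a = k + j + 1 + (C.per a - (k + j + 1)) := by
    have : k + j < C.per a := hi
    omega
  obtain ⟨m, hm⟩ : ∃ m, m = C.per a - (k + j + 1) := ⟨_, rfl⟩
  rw [← hm] at hper
  have hu : ∀ b ∈ C.seg (C.next^[k] a) j, b ∉ C.cut := by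
    intro b hb hb'
    obtain ⟨n, hn, rfl⟩ := C.mem_seg.1 hb
    rw [hiter] at hb'
    have := C.cut_unique a (n + k) (show _ < C.per a by omega) (k + j) hi hb' hc
    omega
  have hv : ∀ b ∈ C.seg (C.next^[k + j + 1] a) m, b ∉ C.cut := by
    intro b hb hb'
    obtain ⟨n, hn, rfl⟩ := C.mem_seg.1 hb
    rw [hiter] at hb'
    have := C.cut_unique a (n + (k + j + 1)) (show _ < C.per a by omega) (k + j) hi hb' hc
    omega
  -- The complement meets exactly one cut arrow c, at position k + j from `a`, and splits around it
  -- as u c v.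
  have hseg : C.seg (C.next^[k] a) (C.per a - k) = C.seg (C.next^[k] a) j ++
      C.next^[k + j] a :: C.seg (C.next^[k + j + 1] a) m := by
    have : C.per a - k = j + (m + 1) := by omega
    rw [this, seg_add, hiter, seg_succ, add_comm j k, ← Function.iterate_succ_apply' (⇑C.next)]
  -- Read from c onwards, the rest of the cycle is v, then the given segment p, then u.
  have hcseg : C.seg (C.next (C.next^[k + j] a)) (C.per (C.next^[k + j] a) - 1) =
      C.seg (C.next^[k + j + 1] a) m ++ (C.seg a k ++ C.seg (C.next^[k] a) j) := by
    have : C.per a - 1 = m + (k + j) := by omega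
    rw [per_iterate, this, ← seg_add, ← Function.iterate_succ_apply' (⇑C.next), seg_add, hiter]
    have : m + (k + j).succ = C.per a := by omega
    rw [this, next_per]
  obtain ⟨u, hu⟩ := C.exists_map_val_eq hu
  obtain ⟨v, hv⟩ := C.exists_map_val_eq hv
  rw [hseg, ← hu, ← hv, word_append, word_cons, map_mul, map_mul, toTriv_word_map,
    toTriv_word_map, toTriv_arrow, C.arrowImage_cut K hc, inr_mul_inl, inl_mul_inr]
  congr 1
  refine C.dual_ext K fun z => ?_
  -- At z the left side becomes the coefficient of vpu in vzu, which is the coefficient of p in z.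
  rw [DualBimodule.smul_apply, DualBimodule.op_smul_apply, ← map_mul, ← map_mul, dual_proj,
    dual_proj]
  have hwu : C.sub.IsWalk (Q.s (C.next^[k] a)) u (Q.s (C.next^[k + j] a)) := by
    have := C.isWalk_seg (C.next^[k] a) j
    rw [← hu, ← isWalk_sub, hiter, add_comm j k] at this
    exact this
  have hwv : C.sub.IsWalk (Q.s (C.next^[k + j + 1] a)) v (Q.s a) := by
    have := C.isWalk_seg (C.next^[k + j + 1] a) m
    rw [← hv, ← isWalk_sub, hiter] at this
    have hm : m + (k + j + 1) = C.per a := by omega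
    rwa [hm, next_per] at this
  have hwp := (C.segPath a k h).1.isWalk
  have hwpu : C.sub.IsWalk (Q.s a) ((C.segPath a k h).1.arrows ++ u)
      (Q.s (C.next^[k + j] a)) := hwp.append hwu
  have hwvpu := hwv.append hwpu
  have heq : (C.cutPath _ hc).1 = ⟨_, _, _, hwvpu⟩ := by
    refine QPath.ext ?_ (C.val_injective.list_map ?_) (C.target_cutPath _ hc)
    · exact congrArg Q.s (Function.iterate_succ_apply' C.next (k + j) a).symm
    · rw [cutPath, map_segPath, hcseg, List.map_append, List.map_append, map_segPath, hu, hv]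
  rw [heq, coeff_word_mul K hwvpu hwv hwpu, coeff_mul_word K hwpu hwp hwu]
  rfl

/-- The cycle which starts with a given arrow. -/
def cycle (a : Q.E) : List Q.E := C.seg a (C.per a)

theorem toTriv_cycle (a : Q.E) :
    C.toTriv K (word K (C.cycle a)) = inr (C.dual K (C.segPath a 0 (by simp))) :=
  C.toTriv_complement K a 0 (by simp)

/-- A trivial path depends only on its vertex. Hence cycles starting at the same vertex have the
same image, which is the first kind of relation. -/
theorem dual_segPath_zero (a b : Q.E) (h : Q.s a = Q.s b) :
    C.dual K (C.segPath a 0 (by simp)) = C.dual K (C.segPath b 0 (by simp)) := by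
  rw [C.nonzeroPath_ext (p := C.segPath a 0 (by simp)) (q := C.segPath b 0 (by simp)) h]
  rw [map_segPath, map_segPath]
  rfl

theorem cycle_eq_cons (a : Q.E) : C.cycle a = a :: C.seg (C.next a) (C.per a - 1) := by
  rw [← seg_succ, Nat.sub_add_cancel (C.per_pos a), cycle]

theorem cycle_head (a : Q.E) : (C.cycle a).head? = some a := by
  rw [cycle_eq_cons, List.head?_cons]

theorem isWalk_cycle (a : Q.E) : Q.IsWalk (Q.s a) (C.cycle a) (Q.s a) := by
  have := C.isWalk_seg a (C.per a)
  rwa [next_per] at this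

theorem s_eq_of_isWalk_cycle {a : Q.E} {x y : Q.V} (h : Q.IsWalk x (C.cycle a) y) :
    Q.s a = x := by
  rw [cycle_eq_cons] at h
  exact h.1

theorem arrows_segPath_zero (a : Q.E) (h : ∀ i < 0, C.next^[i] a ∉ C.cut) :
    (C.segPath a 0 h).1.arrows = [] :=
  List.map_eq_nil_iff.1 (C.map_segPath a 0 h)

theorem eq_of_mem_head? {a b : Q.E} {k : ℕ} (h : b ∈ (C.seg a k).head?) : b = a := by
  cases k with
  | zero => simp [seg] at h
  | succ k => rw [seg_succ] at h; simpa using h.symm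

theorem next_eq_of_mem_getLast? {a b : Q.E} {k : ℕ} (h : b ∈ (C.seg a k).getLast?) :
    C.next b = C.next^[k] a := by
  cases k with
  | zero => simp [seg] at h
  | succ k =>
    rw [seg_add, seg_succ, List.getLast?_append] at h
    have : C.next^[k] a = b := by simpa [seg] using h
    rw [← this, ← Function.iterate_succ_apply' (⇑C.next)]

/-- The cycle goes to the functional of a trivial path. Its product with a cut arrow lies in the
square of the dual, which is zero; its product with a kept arrow vanishes because no multiple a z of
an arrow has a trivial path in its support. -/
theorem toTriv_cycle_concat (a : Q.E) : C.toTriv K (word K (C.cycle a ++ [a])) = 0 := by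
  rw [word_append, map_mul, toTriv_cycle, word_cons, word_nil, mul_one, toTriv_arrow]
  by_cases h : a ∈ C.cut
  · rw [C.arrowImage_cut K h, inr_mul_inr]
  · obtain ⟨b, hb⟩ := C.exists_val_eq h
    rw [← hb, arrowImage_val, inr_mul_inl, ← inr_zero]
    congr 1
    refine C.dual_ext K fun z => ?_
    rw [DualBimodule.op_smul_apply, ← map_mul, dual_proj, coeff_arrow_mul_of_head?_ne]
    · rfl
    · simp [C.arrows_segPath_zero]

/-- Absence of fixed points makes every cycle have at least two arrows, so consecutive arrows never
give a generator of the third kind. -/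
theorem cycle_infix (a : Q.E) : [a, C.next a] <:+: C.cycle a := by
  have h2 : 2 ≤ C.per a := by
    have h1 := C.per_pos a
    by_contra h
    have : C.per a = 1 := by omega
    have := C.next_per a
    rw [‹C.per a = 1›] at this
    exact C.next_ne a this
  obtain ⟨m, hm⟩ := Nat.exists_eq_add_of_le h2
  exact ⟨[], C.seg (C.next (C.next a)) m, by rw [cycle, hm, add_comm, seg_succ, seg_succ]; rfl⟩

theorem eq_next_of_infix {a b c : Q.E} (h : [a, b] <:+: C.cycle c) : b = C.next a :=
  List.isChain_pair (R := fun a b => b = C.next a).1 ((C.isChain_seg c _).infix h)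

/-- Two cut arrows multiply to zero in the dual, two kept ones by the monomial relations. In the
mixed cases the rest of the cycle of the cut arrow can only begin with the successor of that arrow
and end with its predecessor, so the other arrow kills its functional. -/
theorem toTriv_pair {a b : Q.E} (h : b ≠ C.next a) : C.toTriv K (word K [a, b]) = 0 := by
  rw [word_cons, word_cons, word_nil, mul_one, map_mul, toTriv_arrow, toTriv_arrow]
  by_cases ha : a ∈ C.cut <;> by_cases hb : b ∈ C.cut
  · rw [C.arrowImage_cut K ha, C.arrowImage_cut K hb, inr_mul_inr]
  · obtain ⟨b, rfl⟩ := C.exists_val_eq hb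
    rw [C.arrowImage_cut K ha, arrowImage_val, inr_mul_inl, ← inr_zero]
    congr 1
    refine C.dual_ext K fun z => ?_
    rw [DualBimodule.op_smul_apply, ← map_mul, dual_proj]
    refine coeff_arrow_mul_of_head?_ne K (fun hb => h ?_) z
    refine C.eq_of_mem_head? (k := C.per a - 1) ?_
    rw [← C.map_segPath _ _ (C.cutPath_uncut a ha), List.head?_map]
    exact Option.mem_map_of_mem _ hb
  · obtain ⟨a, rfl⟩ := C.exists_val_eq ha
    rw [C.arrowImage_cut K hb, arrowImage_val, inl_mul_inr, ← inr_zero]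
    congr 1
    refine C.dual_ext K fun z => ?_
    rw [DualBimodule.smul_apply, ← map_mul, dual_proj]
    refine coeff_mul_arrow_of_getLast?_ne K (fun ha => h ?_) z
    rw [C.next_eq_of_mem_getLast? (a := C.next b) (k := C.per b - 1)]
    · rw [← Function.iterate_succ_apply, Nat.succ_eq_add_one, Nat.sub_add_cancel (C.per_pos b),
        C.next_per]
    · rw [← C.map_segPath _ _ (C.cutPath_uncut b hb), List.getLast?_map]
      exact Option.mem_map_of_mem _ ha
  · obtain ⟨a, rfl⟩ := C.exists_val_eq ha
    obtain ⟨b, rfl⟩ := C.exists_val_eq hb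
    have := word_pair_mem (K := K) (r := C.rel) h
    rw [word_cons, word_cons, word_nil, mul_one] at this
    rw [arrowImage_val, arrowImage_val, ← inl_mul, ← map_mul,
      (QuiverQuotient.mk_eq_zero _).2 this, inl_zero]

end CutCycles

/-! ### Indecomposability -/

theorem IsIndecomposableRing.of_ringEquiv {A B : Type*} [Ring A] [Ring B] (e : A ≃+* B)
    (h : IsIndecomposableRing A) : IsIndecomposableRing B := by
  have := h.1
  refine ⟨e.symm.toEquiv.nontrivial, fun f hf hc => ?_⟩
  refine (h.2 (e.symm f) (by rw [← map_mul, hf]) fun x => ?_).imp (fun h => ?_) fun h => ?_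
  · rw [← e.symm_apply_apply x, ← map_mul, ← map_mul, hc]
  · simpa using h
  · simpa using h

/-- For e central, f (x e) = f (e x) for every functional f, so (e, 0) commutes with the dual as
well. -/
theorem IsIndecomposableRing.of_trivialExtension {K : Type u} [Field K] {A : Type w} [Ring A]
    [Algebra K A] (h : IsIndecomposableRing (TrivialExtension K A)) : IsIndecomposableRing A := by
  refine ⟨?_, fun e he hc => ?_⟩
  · by_contra hA
    rw [not_nontrivial_iff_subsingleton] at hA
    have := h.1
    refine zero_ne_one (α := TrivialExtension K A) ?_
    rw [← TrivSqZeroExt.inl_one, Subsingleton.elim (1 : A) 0, TrivSqZeroExt.inl_zero]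
  · refine (h.2 (TrivSqZeroExt.inl e) ?_ fun x => ?_).imp (fun h => ?_) fun h => ?_
    · rw [TrivSqZeroExt.inl_mul_inl, he]
    · refine TrivSqZeroExt.ext ?_ ?_
      · simpa using hc x.fst
      · simp only [TrivSqZeroExt.snd_mul, TrivSqZeroExt.fst_inl, TrivSqZeroExt.snd_inl]
        rw [smul_zero, smul_zero, add_zero, zero_add]
        exact DualBimodule.ext fun y => congrArg x.snd (hc y).symm
    · exact congrArg TrivSqZeroExt.fst h
    · exact congrArg TrivSqZeroExt.fst h

/-! ### The isomorphism between the algebra of the cycles and the trivial extension -/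

namespace CutCycles

open PathAlgebra monomialIdeal TrivSqZeroExt

variable {Q : FinQuiver.{v}} (C : CutCycles Q) (K : Type u) [Field K]

/-- The relations of the algebra defined by the cycles. -/
abbrev ideal : TwoSidedIdeal (PathAlgebra K Q) := cycleIdeal K (Set.range C.cycle)

/-- The algebra defined by the cycles. -/
abbrev cycleAlg := QuiverQuotient K Q (C.ideal K)

/-- The projection onto `C.cycleAlg K`. -/
abbrev toCycleAlg : PathAlgebra K Q →ₐ[K] C.cycleAlg K := QuiverQuotient.mk _

theorem toCycleAlg_eq_zero {x : PathAlgebra K Q} : C.toCycleAlg K x = 0 ↔ x ∈ C.ideal K :=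
  QuiverQuotient.mk_eq_zero _

theorem pair_mem {a b : Q.E} (h : b ≠ C.next a) : word K [a, b] ∈ C.ideal K := by
  by_cases hab : Q.t a = Q.s b
  · refine TwoSidedIdeal.subset_span (Or.inr ⟨a, b, hab, ?_, rfl⟩)
    rintro _ ⟨c, rfl⟩ hc
    exact h (C.eq_next_of_infix hc)
  · have : word K [a, b] = 0 := by simp [arrow_mul_arrow_of_ne K hab]
    rw [this]
    exact zero_mem _

theorem cycle_concat_mem (a : Q.E) : word K (C.cycle a ++ [a]) ∈ C.ideal K :=
  TwoSidedIdeal.subset_span (Or.inl (Or.inr ⟨_, ⟨a, rfl⟩, a, C.cycle_head a, rfl⟩))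

theorem toCycleAlg_cycle_eq {a b : Q.E} (h : Q.s a = Q.s b) :
    C.toCycleAlg K (word K (C.cycle a)) = C.toCycleAlg K (word K (C.cycle b)) := by
  rw [← sub_eq_zero, ← map_sub, toCycleAlg_eq_zero]
  exact TwoSidedIdeal.subset_span (Or.inl (Or.inl ⟨_, ⟨a, rfl⟩, _, ⟨b, rfl⟩, Q.s a,
    C.isWalk_cycle a, h ▸ C.isWalk_cycle b, rfl⟩))

theorem ideal_le_ker : C.ideal K ≤ TwoSidedIdeal.ker (C.toTriv K) := by
  refine TwoSidedIdeal.span_le.2 ?_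
  rintro _ ((⟨_, ⟨a, rfl⟩, _, ⟨b, rfl⟩, x, ha, hb, rfl⟩ | ⟨_, ⟨a, rfl⟩, b, hb, rfl⟩) |
    ⟨a, b, -, hab, rfl⟩)
  · refine (TwoSidedIdeal.mem_ker _).2 ?_
    rw [map_sub, toTriv_cycle, toTriv_cycle, C.dual_segPath_zero K a b, sub_self]
    rw [C.s_eq_of_isWalk_cycle ha, C.s_eq_of_isWalk_cycle hb]
  · refine (TwoSidedIdeal.mem_ker _).2 ?_
    rw [cycle_head] at hb
    obtain rfl := Option.some.inj hb
    exact C.toTriv_cycle_concat K a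
  · refine (TwoSidedIdeal.mem_ker _).2 (C.toTriv_pair K ?_)
    rintro rfl
    exact hab _ ⟨a, rfl⟩ (C.cycle_infix a)

/-- The homomorphism from the algebra defined by the cycles to the trivial extension. -/
def cycleAlgToTriv : C.cycleAlg K →ₐ[K] TrivialExtension K (C.subAlg K) :=
  QuiverQuotient.lift _ (C.toTriv K) (C.ideal_le_ker K)

theorem cycleAlgToTriv_toCycleAlg (x : PathAlgebra K Q) :
    C.cycleAlgToTriv K (C.toCycleAlg K x) = C.toTriv K x := rfl

theorem isPathSystem_sub : IsPathSystem (Q := C.sub)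
    (fun x : Q.V => C.toCycleAlg K (vertex K x))
    (fun a => C.toCycleAlg K (arrow K (C.val a))) := by
  have H := (PathAlgebra.isPathSystem K (Q := Q)).map (C.toCycleAlg K).toRingHom
  exact ⟨H.idem, H.orth, H.sum, fun a => H.left (C.val a), fun a => H.right (C.val a)⟩

theorem lift_sub_single (p : QPath C.sub) :
    PathAlgebra.lift K (C.isPathSystem_sub K) (single K p) =
      C.toCycleAlg K (vertex K (Q := Q) p.source) *
        C.toCycleAlg K (word K (p.arrows.map C.val)) := by
  refine (lift_single K (C.isPathSystem_sub K) p).trans ?_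
  congr 1
  induction p.arrows with
  | nil => simp
  | cons a l ih => rw [List.map_cons, List.prod_cons, List.map_cons, word_cons, map_mul, ih]

/-- The inclusion of the subalgebra. -/
def incl : C.subAlg K →ₐ[K] C.cycleAlg K :=
  QuiverQuotient.lift _ (PathAlgebra.lift K (C.isPathSystem_sub K)) <| by
    refine TwoSidedIdeal.span_le.2 ?_
    rintro _ ⟨p, ⟨a, b, hp, hab⟩, rfl⟩
    refine (TwoSidedIdeal.mem_ker _).2 ?_
    rw [lift_sub_single, hp, List.map_cons, List.map_cons, List.map_nil,
      (C.toCycleAlg_eq_zero K).2 (C.pair_mem K hab), mul_zero]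

theorem incl_proj_single (p : QPath C.sub) :
    C.incl K (C.proj K (single K p)) = C.toCycleAlg K (vertex K (Q := Q) p.source) *
      C.toCycleAlg K (word K (p.arrows.map C.val)) := C.lift_sub_single K p

theorem cycleAlgToTriv_incl (x : C.subAlg K) : C.cycleAlgToTriv K (C.incl K x) = inl x := by
  have : ((C.cycleAlgToTriv K).comp (C.incl K)).comp (C.proj K) =
      (inlAlgHom K (C.subAlg K) (DualBimodule K (C.subAlg K))).comp (C.proj K) := by
    refine PathAlgebra.algHom_ext K (fun x => ?_) fun a => ?_
    · refine (congrArg (C.cycleAlgToTriv K) (lift_vertex K (C.isPathSystem_sub K) x)).trans ?_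
      exact C.toTriv_vertex K x
    · refine (congrArg (C.cycleAlgToTriv K) (lift_arrow K (C.isPathSystem_sub K) a)).trans ?_
      exact (C.toTriv_arrow K _).trans (C.arrowImage_val K a)
  obtain ⟨z, rfl⟩ := QuiverQuotient.mk_surjective _ x
  exact DFunLike.congr_fun this z

/-- An arrow whose cycle starts with the given path. -/
def base (p : NonzeroPath C.rel) : Q.E := (C.exists_eq_segPath p).choose

theorem base_spec (p : NonzeroPath C.rel) : ∃ h, p = C.segPath (C.base p) p.1.length h :=
  (C.exists_eq_segPath p).choose_spec

theorem s_base (p : NonzeroPath C.rel) : Q.s (C.base p) = p.1.source := by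
  obtain ⟨h, hp⟩ := C.base_spec p
  exact congrArg (fun q : NonzeroPath C.rel => q.1.source) hp.symm

theorem seg_base (p : NonzeroPath C.rel) :
    C.seg (C.base p) p.1.length = p.1.arrows.map C.val := by
  obtain ⟨h, hp⟩ := C.base_spec p
  rw [← C.map_segPath _ _ h, ← hp]

/-- The complement of a path in a cycle. -/
def complement (p : NonzeroPath C.rel) : C.cycleAlg K :=
  C.toCycleAlg K
    (word K (C.seg (C.next^[p.1.length] (C.base p)) (C.per (C.base p) - p.1.length)))

theorem cycleAlgToTriv_complement (p : NonzeroPath C.rel) :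
    C.cycleAlgToTriv K (C.complement K p) = inr (C.dual K p) := by
  obtain ⟨h, hp⟩ := C.base_spec p
  rw [complement, cycleAlgToTriv_toCycleAlg, C.toTriv_complement K _ _ h, ← hp]

instance : Fintype (NonzeroPath C.rel) := Fintype.ofFinite _

/-- The linear map from the trivial extension to the algebra defined by the cycles. -/
def trivToCycleAlg : TrivialExtension K (C.subAlg K) →ₗ[K] C.cycleAlg K where
  -- The functional is expanded in the dual basis, its coordinates being its values on the basis
  -- paths. Linearity suffices, since multiplicativity is known for the map in the other direction.
  toFun z := C.incl K z.fst + ∑ p, z.snd (basis K C.rel p) • C.complement K p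
  map_add' x y := by
    have : ∀ p, (x + y).snd (basis K C.rel p) =
      x.snd (basis K C.rel p) + y.snd (basis K C.rel p) := fun _ => rfl
    simp only [fst_add, map_add, this, add_smul, Finset.sum_add_distrib]
    abel
  map_smul' c x := by
    have : ∀ p, (c • x).snd (basis K C.rel p) = c * x.snd (basis K C.rel p) := fun _ => rfl
    simp only [fst_smul, map_smul, this, mul_smul, smul_add, Finset.smul_sum, RingHom.id_apply]

theorem cycleAlgToTriv_trivToCycleAlg (z : TrivialExtension K (C.subAlg K)) :
    C.cycleAlgToTriv K (C.trivToCycleAlg K z) = z := by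
  have : z.snd = ∑ p, z.snd (basis K C.rel p) • C.dual K p := by
    refine (basis K C.rel).ext (f₁ := z.snd) fun q => ?_
    refine Eq.trans ?_ (LinearMap.sum_apply Finset.univ
      (fun p => (z.snd (basis K C.rel p) • C.dual K p : C.subAlg K →ₗ[K] K)) _).symm
    rw [Finset.sum_eq_single q]
    · refine Eq.symm ((congrArg (z.snd (basis K C.rel q) * ·) (coord_basis K C.rel q q)).trans ?_)
      simp only [if_true, mul_one]
      rfl
    · intro p _ hp
      refine (congrArg (z.snd (basis K C.rel p) * ·) (coord_basis K C.rel p q)).trans ?_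
      simp [hp.symm]
    · simp
  refine (map_add _ _ _).trans ?_
  rw [cycleAlgToTriv_incl, map_sum]
  simp only [map_smul, cycleAlgToTriv_complement, ← inr_smul]
  rw [← inr_sum, ← this, inl_fst_add_inr_snd_eq]

theorem incl_mem_range (x : C.subAlg K) : C.incl K x ∈ LinearMap.range (C.trivToCycleAlg K) := by
  refine ⟨inl x, ?_⟩
  change C.incl K x + ∑ p, (0 : K) • C.complement K p = _
  simp

theorem complement_mem_range (p : NonzeroPath C.rel) :
    C.complement K p ∈ LinearMap.range (C.trivToCycleAlg K) := by
  refine ⟨inr (C.dual K p), ?_⟩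
  change C.incl K 0 + ∑ q, coord K p (basis K C.rel q) • C.complement K q = _
  simp only [coord_basis, map_zero, zero_add]
  simp

/-- The length must be positive because the empty word is 1 and not a vertex. The cases are a
segment shorter than, equal to, or longer than the full cycle. -/
theorem seg_mem_range (a : Q.E) (k : ℕ) (hk : 0 < k) :
    C.toCycleAlg K (word K (C.seg a k)) ∈ LinearMap.range (C.trivToCycleAlg K) := by
  rcases lt_trichotomy k (C.per a) with h | rfl | h
  · by_cases hu : ∀ i < k, C.next^[i] a ∉ C.cut
    · have hw := C.isWalk_seg a k
      have hne : C.seg a k ≠ [] := fun h => by simpa [h, hk.ne] using C.length_seg a k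
      have h1 := C.incl_mem_range K (C.proj K (single K (C.segPath a k hu).1))
      rw [incl_proj_single, map_segPath, ← map_mul] at h1
      have h2 := single_eq K (⟨_, _, _, hw⟩ : QPath Q)
      rw [← word_eq_single K hw hne] at h2
      rw [h2]
      exact h1
    · push Not at hu
      obtain ⟨i, hi, hc⟩ := hu
      -- The cut arrow of this turn lies in the segment, so the remaining part of the cycle avoids
      -- it and is a basis path whose complement is the segment.
      have hv : ∀ j < C.per a - k, C.next^[j] (C.next^[k] a) ∉ C.cut := by
        intro j hj hj'
        rw [← Function.iterate_add_apply] at hj'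
        have := C.cut_unique a i (hi.trans h) (j + k) (show _ < C.per a by omega) hc hj'
        omega
      set p := C.segPath _ _ hv with hp
      have hl : p.1.length = C.per a - k := by
        rw [QPath.length, ← List.length_map C.val, hp, map_segPath, length_seg]
      -- As this path is not trivial, its first arrow determines the chosen `base`.
      have hb : C.base p = C.next^[k] a := by
        have := (C.seg_base p).trans (C.map_segPath _ _ hv)
        rw [hl] at this
        obtain ⟨m, hm⟩ : ∃ m, C.per a - k = m + 1 := ⟨C.per a - k - 1, by omega⟩
        rw [hm, seg_succ, seg_succ] at this
        exact (List.cons.inj this).1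
      have := C.complement_mem_range K p
      rw [complement, hl, hb, per_iterate, ← Function.iterate_add_apply,
        Nat.sub_add_cancel h.le, next_per, Nat.sub_sub_self h.le] at this
      exact this
  · have h0 : ∀ i < 0, C.next^[i] a ∉ C.cut := by simp
    have := C.complement_mem_range K (C.segPath a 0 h0)
    have hl : (C.segPath a 0 h0).1.length = 0 := by
      rw [QPath.length, arrows_segPath_zero, List.length_nil]
    rw [complement, hl] at this
    change C.toCycleAlg K (word K (C.cycle (C.base (C.segPath a 0 h0)))) ∈ _ at this
    -- For a trivial path `base` may be another arrow at the same vertex; the first kind of relation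
    -- identifies the two cycles.
    rwa [C.toCycleAlg_cycle_eq K (C.s_base _)] at this
  · obtain ⟨m, rfl⟩ := Nat.exists_eq_add_of_lt h
    -- A longer segment begins with a full cycle followed by its first arrow, which is a relation.
    have : C.seg a (C.per a + m + 1) = (C.cycle a ++ [a]) ++ C.seg (C.next a) m := by
      rw [add_assoc, seg_add, next_per, seg_succ, cycle, List.append_assoc]
      rfl
    rw [this, word_append, map_mul, (C.toCycleAlg_eq_zero K).2 (C.cycle_concat_mem K a), zero_mul]
    exact zero_mem _

theorem trivToCycleAlg_surjective : Function.Surjective (C.trivToCycleAlg K) := by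
  refine LinearMap.range_eq_top.1 (eq_top_iff.2 ?_)
  rintro x -
  obtain ⟨x, rfl⟩ := QuiverQuotient.mk_surjective _ x
  induction x using PathAlgebra.induction with
  | h0 => rw [map_zero]; exact zero_mem _
  | ha x y hx hy => rw [map_add]; exact add_mem hx hy
  | hm c x hx => rw [map_smul]; exact Submodule.smul_mem _ c hx
  | hs p =>
    by_cases hp : p.arrows.IsChain (fun a b => b = C.next a)
    · obtain ⟨x, l, y, hw⟩ := p
      cases l with
      | nil =>
        cases hw
        have := C.incl_mem_range K (C.proj K (vertex K (Q := C.sub) x))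
        have h : C.incl K (C.proj K (vertex K (Q := C.sub) x)) = C.toCycleAlg K (vertex K x) :=
          lift_vertex K (C.isPathSystem_sub K) x
        rwa [h] at this
      | cons a l =>
        rw [← word_eq_single K hw (by simp), C.eq_seg_of_isChain hp]
        exact C.seg_mem_range K a _ (Nat.succ_pos _)
    · have : C.toCycleAlg K (single K p) = 0 := by
        rw [single_eq, map_mul, (C.toCycleAlg_eq_zero K).2
          (word_mem_of_not_isChain K (fun a b => C.pair_mem K) _ hp), mul_zero]
      rw [this]
      exact zero_mem _

/-- The algebra defined by the cycles is a trivial extension. -/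
def cycleAlgEquiv : C.cycleAlg K ≃ₐ[K] TrivialExtension K (C.subAlg K) :=
  AlgEquiv.ofBijective (C.cycleAlgToTriv K) <| by
    have h := C.cycleAlgToTriv_trivToCycleAlg K
    -- A map with a surjective right inverse is injective.
    refine ⟨fun x y hxy => ?_, fun z => ⟨_, h z⟩⟩
    obtain ⟨x, rfl⟩ := C.trivToCycleAlg_surjective K x
    obtain ⟨y, rfl⟩ := C.trivToCycleAlg_surjective K y
    rw [h, h] at hxy
    rw [hxy]

theorem isTrivialExtensionOfAlmostGentle :
    IsTrivialExtensionOfAlmostGentle.{u, v} K (C.cycleAlg K) :=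
  ⟨C.subAlg K, inferInstance, inferInstance, C.isAlmostGentle_subAlg K,
    fun h => (h.of_ringEquiv (C.cycleAlgEquiv K).toRingEquiv).of_trivialExtension,
    ⟨C.cycleAlgEquiv K⟩⟩

end CutCycles

/-! ### Cut cycles from a permutation of the arrows -/

namespace CutCycles

variable {Q : FinQuiver.{v}}

/-- Every suitable permutation of the arrows can be completed by a choice of one arrow in
every orbit. -/
def ofPerm (σ : Equiv.Perm Q.E) (s_next : ∀ a, Q.s (σ a) = Q.t a) (next_ne : ∀ a, σ a ≠ a)
    (exists_s_eq : ∀ x, ∃ a, Q.s a = x) : CutCycles Q where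
  next := σ
  s_next := s_next
  next_ne := next_ne
  exists_s_eq := exists_s_eq
  cut := Set.range fun x : Quotient (Equiv.Perm.SameCycle.setoid σ) => x.out
  exists_cut a := by
    have h : σ.SameCycle a (Quotient.out (s := Equiv.Perm.SameCycle.setoid σ) ⟦a⟧) :=
      (Quotient.mk_out (s := Equiv.Perm.SameCycle.setoid σ) a).symm
    obtain ⟨i, hi⟩ := h.exists_nat_pow_eq
    -- Some power of σ reaches the representative of the orbit; reducing the exponent modulo the
    -- period brings it within one turn.
    refine ⟨i % Function.minimalPeriod σ a, Nat.mod_lt _ ?_, ?_⟩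
    · exact Function.minimalPeriod_pos_of_mem_periodicPts
        (σ.injective.mem_periodicPts a)
    · rw [Function.iterate_mod_minimalPeriod_eq, Equiv.Perm.iterate_eq_pow, hi]
      exact ⟨_, rfl⟩
  cut_unique a i hi j hj := by
    -- A representative lying in the orbit of `a` is the representative of that orbit. Iterates
    -- within one turn are distinct, so it is met once.
    have key : ∀ k, σ^[k] a ∈ Set.range
        (fun x : Quotient (Equiv.Perm.SameCycle.setoid σ) => x.out) →
        σ^[k] a = Quotient.out (s := Equiv.Perm.SameCycle.setoid σ) ⟦a⟧ := by
      rintro k ⟨x, hx⟩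
      have : x = ⟦a⟧ := by
        rw [← Quotient.out_eq x]
        refine Quotient.sound (s := Equiv.Perm.SameCycle.setoid σ) ?_
        change σ.SameCycle x.out a
        change x.out = _ at hx
        rw [hx, Equiv.Perm.iterate_eq_pow]
        exact Equiv.Perm.SameCycle.symm ⟨k, rfl⟩
      rw [← hx, this]
    intro h h'
    exact Function.iterate_injOn_Iio_minimalPeriod hi hj ((key i h).trans (key j h').symm)

/-- The iterates of the first arrow run through the list cyclically. Without repetitions they return
to it only at multiples of the length, so the period is the length. -/
theorem eq_cycle (C : CutCycles Q) {l : List Q.E} (hl : 0 < l.length) (hn : l.Nodup)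
    (h : ∀ (i : ℕ) (hi : i < l.length),
      C.next l[i] = l[(i + 1) % l.length]'(Nat.mod_lt _ hl)) : l = C.cycle l[0] := by
  have hi : ∀ i, C.next^[i] l[0] = l[i % l.length]'(Nat.mod_lt _ hl) := by
    intro i
    induction i with
    | zero => simp
    | succ i ih =>
      rw [Function.iterate_succ_apply', ih, h]
      simp
  have hp : C.per l[0] = l.length := by
    refine le_antisymm ?_ ?_
    · refine Function.IsPeriodicPt.minimalPeriod_le hl ?_
      rw [Function.IsPeriodicPt, Function.IsFixedPt, hi]
      simp
    · have h1 := hi (C.per l[0])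
      rw [C.next_per, hn.getElem_inj_iff] at h1
      exact Nat.le_of_dvd (C.per_pos _) (Nat.dvd_of_mod_eq_zero h1.symm)
  rw [cycle, hp]
  refine List.ext_getElem (by simp) fun i h1 h2 => ?_
  refine Eq.trans ?_ (List.getElem_iterate _ _ _ _ h2).symm
  rw [hi]
  simp [Nat.mod_eq_of_lt h1]

end CutCycles

theorem cyclePow_one {E : Type v} (l : List E) : cyclePow l 1 = l := by simp [cyclePow]

/-! ### Defining pairs with multiplicity one -/

namespace IsDefiningPair

variable {Q : FinQuiver.{v}} {S : Set (List Q.E)} {ν : List Q.E → ℕ}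

theorem two_le_length (h : IsDefiningPair Q S ν) (hν : ∀ C ∈ S, ν C = 1) {l : List Q.E}
    (hl : l ∈ S) : 2 ≤ l.length := by
  match l, hl with
  | [], hl => exact absurd rfl (h.simple _ hl).1
  | [a], hl => exact absurd (h.loop a hl) (by simp [hν _ hl])
  | a :: b :: l, _ => simp

theorem exists_cons_mem (h : IsDefiningPair Q S ν) (hν : ∀ C ∈ S, ν C = 1) (a : Q.E) :
    ∃ b l, a :: b :: l ∈ S := by
  obtain ⟨l, hl, ha⟩ := h.cover a
  obtain ⟨l₁, l₂, rfl⟩ := List.append_of_mem ha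
  have hr : a :: (l₂ ++ l₁) ∈ S := h.rotate_mem _ hl _ List.isRotated_append
  have h2 := h.two_le_length hν hr
  match l₂ ++ l₁, hr, h2 with
  | b :: l, hr, _ => exact ⟨b, l, hr⟩

/-- The arrow which follows a given arrow in its cycle. -/
def nextArrow (h : IsDefiningPair Q S ν) (a : Q.E) : Q.E := (h.cover a).choose.formPerm a

/-- The successor does not depend on the chosen cycle: two cycles through an arrow are rotations of
each other, and rotated lists without repetitions define the same cyclic permutation. -/
theorem nextArrow_eq (h : IsDefiningPair Q S ν) {a : Q.E} {l : List Q.E} (hl : l ∈ S)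
    (ha : a ∈ l) : h.nextArrow a = l.formPerm a := by
  have hc := (h.cover a).choose_spec
  rw [nextArrow, List.formPerm_eq_of_isRotated (h.simple _ hc.1).2.2
    (h.unique a _ hc.1 _ hl hc.2 ha)]

/-- A common successor lies on both cycles, so they are rotations of each other and define one
permutation, which is injective. -/
theorem nextArrow_injective (h : IsDefiningPair Q S ν) : Function.Injective h.nextArrow := by
  intro a b hab
  obtain ⟨l, hl, ha⟩ := h.cover a
  obtain ⟨l', hl', hb⟩ := h.cover b
  have h1 := List.formPerm_apply_mem_of_mem ha
  have h2 := List.formPerm_apply_mem_of_mem hb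
  rw [← h.nextArrow_eq hl ha] at h1
  rw [← h.nextArrow_eq hl' hb, ← hab] at h2
  have hr := h.unique _ _ hl _ hl' h1 h2
  rw [h.nextArrow_eq hl ha, h.nextArrow_eq hl' hb,
    List.formPerm_eq_of_isRotated (h.simple _ hl).2.2 hr] at hab
  exact Equiv.injective _ hab

/-- The arrows of a quiver with a defining pair, as a union of cycles. -/
def cutCycles (h : IsDefiningPair Q S ν) (hν : ∀ C ∈ S, ν C = 1)
    (hQ : ∀ x : Q.V, ∃ a : Q.E, Q.s a = x ∨ Q.t a = x) : CutCycles Q :=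
  have hs : ∀ a, Q.s (h.nextArrow a) = Q.t a := fun a => by
    obtain ⟨b, l, hl⟩ := h.exists_cons_mem hν a
    have hS := h.simple _ hl
    rw [h.nextArrow_eq hl (by simp), List.formPerm_apply_head _ _ _ hS.2.2]
    obtain ⟨x, hx⟩ := hS.2.1
    exact hx.2.1
  CutCycles.ofPerm (Equiv.ofBijective _ (Finite.injective_iff_bijective.1 h.nextArrow_injective))
    hs
    (fun a => by
      obtain ⟨b, l, hl⟩ := h.exists_cons_mem hν a
      have hS := h.simple _ hl
      rw [Equiv.ofBijective_apply, h.nextArrow_eq hl (by simp)]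
      exact (List.formPerm_apply_mem_ne_self_iff _ hS.2.2 _ (by simp)).2
        (h.two_le_length hν hl))
    -- If the vertex is the end of an arrow, the successor of that arrow starts there.
    (fun x => by
      obtain ⟨a, rfl | rfl⟩ := hQ x
      · exact ⟨a, rfl⟩
      · exact ⟨_, hs a⟩)

theorem eq_cycle (h : IsDefiningPair Q S ν) (hν : ∀ C ∈ S, ν C = 1)
    (hQ : ∀ x : Q.V, ∃ a : Q.E, Q.s a = x ∨ Q.t a = x) {l : List Q.E} (hl : l ∈ S) :
    l = (h.cutCycles hν hQ).cycle
      (l[0]'(Nat.zero_lt_of_lt (h.two_le_length hν hl))) := by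
  have hn := (h.simple _ hl).2.2
  refine CutCycles.eq_cycle _ _ hn fun i hi => ?_
  exact (h.nextArrow_eq hl (List.getElem_mem hi)).trans (List.formPerm_apply_getElem _ hn _ _)

theorem range_cycle (h : IsDefiningPair Q S ν) (hν : ∀ C ∈ S, ν C = 1)
    (hQ : ∀ x : Q.V, ∃ a : Q.E, Q.s a = x ∨ Q.t a = x) :
    Set.range (h.cutCycles hν hQ).cycle = {w | ∃ C ∈ S, w = cyclePow C (ν C)} := by
  ext w
  constructor
  · rintro ⟨a, rfl⟩
    obtain ⟨b, l, hl⟩ := h.exists_cons_mem hν a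
    exact ⟨_, hl, by rw [hν _ hl, cyclePow_one]; exact (h.eq_cycle hν hQ hl).symm⟩
  · rintro ⟨l, hl, rfl⟩
    rw [hν _ hl, cyclePow_one]
    exact ⟨_, (h.eq_cycle hν hQ hl).symm⟩

end IsDefiningPair

/-! ### Brauer configurations with multiplicity one -/

namespace BrauerConfiguration

variable (Γ : BrauerConfiguration.{v})

theorem length_seq (α : Γ.Γ₀) : (Γ.seq α).length = Γ.val α := by
  have := Multiset.sum_count_eq_card (s := Finset.univ) (m := (Γ.seq α : Multiset Γ.Γ₁)) (by simp)
  rw [Multiset.coe_card] at this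
  rw [← this, val]
  refine Finset.sum_congr rfl fun V _ => ?_
  rw [← Γ.count_seq, Multiset.coe_count]

/-- The arrow which follows a given arrow in its special cycle. -/
def nextArrow (a : Γ.quiver.E) : Γ.quiver.E :=
  (⟨a.1, ⟨(a.2.1 + 1) % (Γ.seq a.1.1).length, Nat.mod_lt _ (Nat.zero_lt_of_lt a.2.2)⟩⟩ : Γ.Arrow)

theorem nextArrow_injective : Function.Injective Γ.nextArrow := by
  rintro ⟨α, i, hi⟩ ⟨β, j, hj⟩ h
  obtain ⟨rfl, h⟩ := Sigma.mk.inj_iff.1 h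
  have h := congrArg Fin.val (eq_of_heq h)
  have : i = j := by
    refine Nat.ModEq.eq_of_lt_of_lt (Nat.ModEq.add_right_cancel' 1 h) hi hj
  subst this
  rfl

theorem two_le_length (hμ : ∀ α, Γ.μ α = 1) (α : {α : Γ.Γ₀ // 1 < Γ.val α * Γ.μ α}) :
    2 ≤ (Γ.seq α.1).length := by
  have := α.2
  rwa [hμ, mul_one, ← length_seq] at this

/-- The arrows of the quiver of a Brauer configuration, as a union of cycles. -/
def cutCycles (hμ : ∀ α, Γ.μ α = 1) : CutCycles Γ.quiver :=
  CutCycles.ofPerm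
    (Equiv.ofBijective _ (Finite.injective_iff_bijective.1 Γ.nextArrow_injective))
    (fun _ => rfl)
    (by
      rintro ⟨α, i, hi⟩ h
      have h := congrArg Fin.val (eq_of_heq (Sigma.mk.inj_iff.1 h).2)
      have h2 := Γ.two_le_length hμ α
      change (i + 1) % _ = i at h
      -- Before the last position nothing wraps around; at the last one the successor is position 0,
      -- which differs from i because the length is at least two.
      rcases Nat.lt_or_ge (i + 1) (Γ.seq α.1).length with h' | h'
      · rw [Nat.mod_eq_of_lt h'] at h
        omega
      · have : i + 1 = (Γ.seq α.1).length := by omega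
        rw [this, Nat.mod_self] at h
        omega)
    (fun V => by
      obtain ⟨α, hα, h⟩ := Γ.exists_nontruncated V
      -- The polygon occurs in the cyclic order at its nontruncated vertex, and each such occurrence
      -- is the start of an arrow.
      have hV : (show Γ.Γ₁ from V) ∈ Γ.seq α := by
        rw [← List.count_pos_iff, Γ.count_seq, Multiset.count_pos]
        exact hα
      obtain ⟨i, hi⟩ := List.get_of_mem hV
      exact ⟨(⟨⟨α, h⟩, i⟩ : Γ.Arrow), hi⟩)

theorem specialCycle_eq_cycle (hμ : ∀ α, Γ.μ α = 1) (α : {α : Γ.Γ₀ // 1 < Γ.val α * Γ.μ α})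
    (i : Fin (Γ.seq α.1).length) :
    Γ.specialCycle α i = (Γ.cutCycles hμ).cycle (⟨α, i⟩ : Γ.Arrow) := by
  have hlen : (Γ.specialCycle α i).length = (Γ.seq α.1).length := 
    (List.length_map _).trans ((List.length_rotate _ _).trans List.length_finRange)
  have hget : ∀ (j : ℕ) (hj : j < (Γ.specialCycle α i).length),
      (Γ.specialCycle α i)[j] = (⟨α, ⟨(j + i) % (Γ.seq α.1).length,
        Nat.mod_lt _ (Nat.zero_lt_of_lt i.2)⟩⟩ : Γ.Arrow) := by
    intro j hj
    refine (List.getElem_map _).trans (congrArg (fun j => (⟨α, j⟩ : Γ.Arrow)) ?_)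
    ext
    simp [List.getElem_rotate]
  have h0 : 0 < (Γ.specialCycle α i).length := hlen ▸ Nat.zero_lt_of_lt i.2
  have hn : (Γ.specialCycle α i).Nodup :=
    ((List.nodup_rotate.2 (List.nodup_finRange _)).map fun j j' h =>
      eq_of_heq (Sigma.mk.inj_iff.1 h).2)
  refine ((Γ.cutCycles hμ).eq_cycle h0 hn fun j hj => ?_).trans ?_
  · rw [hget, hget]
    change (⟨α, _⟩ : Γ.Arrow) = _
    congr 2
    simp [hlen, Nat.add_right_comm]
  · rw [hget]
    congr
    simp [Nat.mod_eq_of_lt i.2]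

theorem range_cycle (hμ : ∀ α, Γ.μ α = 1) : Set.range (Γ.cutCycles hμ).cycle =
    {w | ∃ α i, w = cyclePow (Γ.specialCycle α i) (Γ.μ α.1)} := by
  ext w
  constructor
  · rintro ⟨⟨α, i⟩, rfl⟩
    exact ⟨α, i, by rw [hμ, cyclePow_one, Γ.specialCycle_eq_cycle hμ]⟩
  · rintro ⟨α, i, rfl⟩
    rw [hμ, cyclePow_one, Γ.specialCycle_eq_cycle hμ]
    exact ⟨_, rfl⟩

end BrauerConfiguration
end

theorem corollary5p7 (K : Type u) [Field K] :
    (∀ (Q : FinQuiver.{v}) (S : Set (List Q.E)) (ν : List Q.E → ℕ),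
      IsDefiningPair Q S ν → (∀ C ∈ S, ν C = 1) →
      (∀ x : Q.V, ∃ a : Q.E, Q.s a = x ∨ Q.t a = x) →
      IsTrivialExtensionOfAlmostGentle.{u, v} K (AlgebraDefinedByCycles K Q S ν)) ∧
    (∀ Γ : BrauerConfiguration.{v}, (∀ α, Γ.μ α = 1) →
      IsTrivialExtensionOfAlmostGentle.{u, v} K (Γ.BCAlgebra K)) := by
  refine ⟨fun Q S ν h hν hQ => ?_, fun Γ hμ => ?_⟩
  · have := (h.cutCycles hν hQ).isTrivialExtensionOfAlmostGentle K
    unfold CutCycles.cycleAlg CutCycles.ideal at this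
    rwa [h.range_cycle hν hQ] at this
  · have := (Γ.cutCycles hμ).isTrivialExtensionOfAlmostGentle K
    unfold CutCycles.cycleAlg CutCycles.ideal at this
    rwa [Γ.range_cycle hμ] at this
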